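/- Let $d\ge 1$. Let $\Gamma_0$ be the space of finite subsets of $\mathbb R^d$ with the Borel $\sigma$-algebra of the disjoint union over $n\ge 0$ of the spaces $\Gamma^{(n)}$ of $n$-point sets (quotients of $\{(x_1,\dots,x_n)\in(\mathbb R^d)^n: x_i\ne x_j \text{ for } i\neq j\}$ by permutations), and let $\Gamma_0^2=\{(\eta^+,\eta^-)\in\Gamma_0\times\Gamma_0:\eta^+\cap\eta^-=\emptyset\}$. For $z>0$ let $\lambda_z=\sum_{n\ge 0}\frac{z^n}{n!}m^{(n)}$, where $m^{(n)}$ is the image of $dx_1\cdots dx_n$ under $(x_1,\dots,x_n)\mapsto\{x_1,\dots,x_n\}$ (and $m^{(0)}=\delta_\emptyset$), let $\lambda_z^2=\lambda_z\otimes\lambda_z$ on $\Gamma_0^2$, and $\lambda^2=\lambda_1^2$. For $C>0$ put $\mathcal L_C=L^1(\Gamma_0^2,\lambda_C^2)$ (real-valued), i.e. $\|G\|_{\mathcal L_C}=\int_{\Gamma_0^2}|G(\eta^+,\eta^-)|\,C^{|\eta^+|+|\eta^-|}\,d\lambda^2(\eta^+,\eta^-)$. Let $d^\pm,b^\pm:\mathbb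 R^d\times\Gamma_0^2\to[0,\infty)$ be measurable and such that $d^\pm(\cdot,\eta^+,\eta^-),b^\pm(\cdot,\eta^+,\eta^-)\in L^1_{\rm loc}(\mathbb R^d,dx)$ for all $(\eta^+,\eta^-)\in\Gamma_0^2$. Put $$D^\pm(x,\xi^+,\xi^-,\eta^+,\eta^-)=\sum_{\zeta^+\subset\eta^+,\ \zeta^-\subset\eta^-}(-1)^{|\eta^+\setminus\zeta^+|+|\eta^-\setminus\zeta^-|}\,d^\pm(x,\zeta^+\cup\xi^+,\zeta^-\cup\xi^-),$$ and define $B^\pm$ from $b^\pm$ in the same way. (A value of a function on $\Gamma_0^2$ at a pair of non-disjoint sets is read as $0$; this only concerns null sets.) For $G:\Gamma_0^2\to\mathbb R$ consider the expression $$\begin{aligned}(\hat LG)(\eta^+,\eta^-)=&-\sum_{\xi^\pm\subset\eta^\pm}G(\xi^+,\xi^-)\sum_{x\in\xi^+}D^+(x,\xi^+\setminus x,\xi^-,\eta^+\setminus\xi^+,\eta^-\setminus\xi^-)\\&+\sum_{\xi^\pm\subset\eta^\pm}\int_{\mathbb R^d}dx\,G(\xi^+\cup x,\xi^-)\,B^+(x,\xi^+,\xi^-,\eta^+\setminus\xi^+,\eta^-\setminus\xi^-)\\&-\sum_{\xi^\pm\subset\eta^\pm}G(\xi^+,\xi^-)\sum_{y\in\xi^-}D^-(y,\xi^+,\xi^-\setminus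 y,\eta^+\setminus\xi^+,\eta^-\setminus\xi^-)\\&+\sum_{\xi^\pm\subset\eta^\pm}\int_{\mathbb R^d}dy\,G(\xi^+,\xi^-\cup y)\,B^-(y,\xi^+,\xi^-,\eta^+\setminus\xi^+,\eta^-\setminus\xi^-).\end{aligned}\qquad(*)$$ Let $C>0$ and let $N:\Gamma_0^2\to\mathbb R$ be $\lambda^2$-measurable such that 1. $N$ is $\lambda^2$-integrable over $\{(\eta^+,\eta^-)\in\Gamma_0^2:\eta^\pm\subset\Lambda,\ |\eta^+|=n,\ |\eta^-|=m\}$ for all $n,m\ge 1$ and all bounded Borel sets $\Lambda\subset\mathbb R^d$; 2. for $\lambda^2$-a.a. $(\eta^+,\eta^-)\in\Gamma_0^2$, $$\begin{aligned}&\sum_{x\in\eta^+}\bigl\|D^+(x,\eta^+\setminus x,\eta^-,\cdot,\cdot)\bigr\|_{\mathcal L_C}+\frac1C\sum_{x\in\eta^+}\bigl\|B^+(x,\eta^+\setminus x,\eta^-,\cdot,\cdot)\bigr\|_{\mathcal L_C}\\&+\sum_{y\in\eta^-}\bigl\|D^-(y,\eta^+,\eta^-\setminus y,\cdot,\cdot)\bigr\|_{\mathcal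 L_C}+\frac1C\sum_{y\in\eta^-}\bigl\|B^-(y,\eta^+,\eta^-\setminus y,\cdot,\cdot)\bigr\|_{\mathcal L_C}\le N(\eta^+,\eta^-)<\infty.\end{aligned}$$ Then $\mathcal D=\{G\in\mathcal L_C: NG\in\mathcal L_C\}$ is a dense linear subspace of $\mathcal L_C$, and $(*)$ defines a linear operator $\hat L$ in $\mathcal L_C$ with domain $\mathcal D$: for each $G\in\mathcal D$ and each representative of $G$, all integrals in $(*)$ converge absolutely for $\lambda^2$-a.a. $(\eta^+,\eta^-)$, and the right-hand side of $(*)$ is $\lambda^2$-a.e. equal to $\hat LG\in\mathcal L_C$. Moreover $\|\hat LG\|_{\mathcal L_C}\le\|NG\|_{\mathcal L_C}$ for all $G\in\mathcal D$. -/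

import Mathlib

open MeasureTheory
open scoped ENNReal

noncomputable section

namespace BirthDeath

/-- The space `ℝ^d`. -/
abbrev Pt (d : ℕ) : Type := EuclideanSpace ℝ (Fin d)

/-- One-component finite configurations `Γ₀`: finite subsets of `ℝ^d`. (A structure, so that
it does not inherit the cylinder `σ`-algebra that Mathlib puts on `Finset`.) -/
@[ext]
structure Conf (d : ℕ) where
  /-- the set of positions of the particles -/
  pts : Finset (Pt d)

/-- `n`-tuples of pairwise distinct points of `ℝ^d`. -/
abbrev Tuples (d n : ℕ) : Type := {x : Fin n → Pt d // Function.Injective x}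

/-- The map `(x₁, …, xₙ) ↦ {x₁, …, xₙ}`. -/
def toConf {d n : ℕ} (x : Tuples d n) : Conf d :=
  ⟨Finset.univ.map ⟨x.1, x.2⟩⟩

/-- All tuples of distinct points, of every length, mapped onto `Γ₀`. -/
def sigmaToConf (d : ℕ) (x : Σ n : ℕ, Tuples d n) : Conf d :=
  toConf x.2

/-- The topology of `Γ₀`: the disjoint union over `n` of the quotients of the spaces of
`n`-tuples of distinct points by permutations of the coordinates. -/
instance instTopologicalSpaceConf (d : ℕ) : TopologicalSpace (Conf d) :=
  TopologicalSpace.coinduced (sigmaToConf d) inferInstance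

/-- The Borel `σ`-algebra of `Γ₀`. -/
instance instMeasurableSpaceConf (d : ℕ) : MeasurableSpace (Conf d) := borel (Conf d)

instance instBorelSpaceConf (d : ℕ) : BorelSpace (Conf d) := ⟨rfl⟩

theorem mem_toConf {d n : ℕ} (x : Tuples d n) (y : Pt d) :
    y ∈ (toConf x).pts ↔ ∃ i, x.1 i = y := by
  simp [toConf]

theorem continuous_toConf {d n : ℕ} : Continuous (toConf : Tuples d n → Conf d) :=
  (continuous_coinduced_rng (f := sigmaToConf d)).comp
    (continuous_sigmaMk (σ := fun n => Tuples d n) (i := n))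

theorem sigmaToConf_surjective (d : ℕ) : Function.Surjective (sigmaToConf d) := by
  intro s
  refine ⟨⟨s.pts.card, ⟨fun i => (s.pts.equivFin.symm i : Pt d),
    fun i j h => s.pts.equivFin.symm.injective (Subtype.ext h)⟩⟩, ?_⟩
  ext y
  rw [sigmaToConf, mem_toConf]
  constructor
  · rintro ⟨i, rfl⟩
    exact (s.pts.equivFin.symm i).2
  · intro hy
    exact ⟨s.pts.equivFin ⟨y, hy⟩, by simp⟩

/-- Relabelling the points of a tuple. -/
def permute {d n : ℕ} (e : Equiv.Perm (Fin n)) (x : Tuples d n) : Tuples d n :=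
  ⟨x.1 ∘ e, x.2.comp e.injective⟩

theorem toConf_permute {d n : ℕ} (e : Equiv.Perm (Fin n)) (x : Tuples d n) :
    toConf (permute e x) = toConf x := by
  ext y
  simp only [mem_toConf, permute, Function.comp]
  exact ⟨fun ⟨i, hi⟩ => ⟨e i, hi⟩, fun ⟨i, hi⟩ => ⟨e.symm i, by simpa using hi⟩⟩

theorem card_toConf {d n : ℕ} (x : Tuples d n) : (toConf x).pts.card = n := by
  simp [toConf]

theorem exists_permute_of_toConf_eq {d n : ℕ} {x y : Tuples d n}
    (h : toConf x = toConf y) : ∃ e : Equiv.Perm (Fin n), permute e x = y := by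
  have hy : ∀ i, ∃ j, x.1 j = y.1 i := by
    intro i
    rw [← mem_toConf, h, mem_toConf]
    exact ⟨i, rfl⟩
  choose f hf using hy
  have hinj : Function.Injective f := fun i j hij => y.2 (by rw [← hf i, ← hf j, hij])
  exact ⟨Equiv.ofBijective f (Finite.injective_iff_bijective.1 hinj), Subtype.ext (funext hf)⟩

theorem continuous_permute {d n : ℕ} (e : Equiv.Perm (Fin n)) :
    Continuous (permute e : Tuples d n → Tuples d n) := by
  refine Continuous.subtype_mk ?_ _
  exact continuous_pi fun i => (continuous_apply (e i)).comp continuous_subtype_val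

theorem isOpenMap_sigmaToConf (d : ℕ) : IsOpenMap (sigmaToConf d) := by
  intro U hU
  rw [isOpen_coinduced, isOpen_sigma_iff]
  intro n
  have : Sigma.mk n ⁻¹' (sigmaToConf d ⁻¹' (sigmaToConf d '' U)) =
      ⋃ e : Equiv.Perm (Fin n), permute e ⁻¹' (Sigma.mk n ⁻¹' U) := by
    ext x
    simp only [Set.mem_preimage, Set.mem_image, Set.mem_iUnion]
    constructor
    · rintro ⟨⟨m, y⟩, hy, hxy⟩
      have hm : m = n := by
        rw [← card_toConf x, ← card_toConf y]
        exact congrArg (fun c : Conf d => c.pts.card) hxy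
      subst hm
      obtain ⟨e, rfl⟩ := exists_permute_of_toConf_eq (x := x) (y := y) hxy.symm
      exact ⟨e, hy⟩
    · rintro ⟨e, he⟩
      exact ⟨_, he, toConf_permute e x⟩
  rw [this]
  exact isOpen_iUnion fun e =>
    ((hU.preimage continuous_sigmaMk).preimage (continuous_permute e))

theorem isOpenQuotientMap_sigmaToConf (d : ℕ) : IsOpenQuotientMap (sigmaToConf d) :=
  ⟨sigmaToConf_surjective d, continuous_coinduced_rng, isOpenMap_sigmaToConf d⟩

/-- In particular the product `σ`-algebra of `Γ₀ × Γ₀` is the Borel `σ`-algebra of the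
product topology. -/
instance instSecondCountableConf (d : ℕ) : SecondCountableTopology (Conf d) :=
  (isOpenQuotientMap_sigmaToConf d).isQuotientMap.secondCountableTopology
    (isOpenMap_sigmaToConf d)

/-- Two-component finite configurations `Γ₀²`: pairs of disjoint finite configurations, with
the topology and the (Borel) `σ`-algebra induced from `Γ₀ × Γ₀`. -/
abbrev Conf2 (d : ℕ) : Type := {η : Conf d × Conf d // Disjoint η.1.pts η.2.pts}

theorem borelSpace_conf2 (d : ℕ) : BorelSpace (Conf2 d) := inferInstance

/-- `Γ₀²` is a measurable subset of `Γ₀ × Γ₀`. -/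
theorem measurableSet_conf2 (d : ℕ) :
    MeasurableSet {η : Conf d × Conf d | Disjoint η.1.pts η.2.pts} := by
  apply IsOpen.measurableSet
  have hq := (isOpenQuotientMap_sigmaToConf d).prodMap (isOpenQuotientMap_sigmaToConf d)
  rw [← hq.isQuotientMap.isOpen_preimage, isOpen_iff_mem_nhds]
  rintro ⟨⟨n, x⟩, ⟨m, y⟩⟩ hxy
  have hT : IsOpen {p : Tuples d n × Tuples d m | ∀ i j, p.1.1 i ≠ p.2.1 j} := by
    simp only [Set.ofPred_forall]
    refine isOpen_iInter_of_finite fun i => isOpen_iInter_of_finite fun j => ?_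
    exact isOpen_ne_fun
      ((continuous_apply i).comp (continuous_subtype_val.comp continuous_fst))
      ((continuous_apply j).comp (continuous_subtype_val.comp continuous_snd))
  have hdisj : ∀ (x : Tuples d n) (y : Tuples d m),
      Disjoint (toConf x).pts (toConf y).pts ↔ ∀ i j, x.1 i ≠ y.1 j := by
    intro x y
    simp only [Finset.disjoint_left, mem_toConf]
    constructor
    · intro h i j hij
      exact h ⟨i, rfl⟩ ⟨j, hij.symm⟩
    · rintro h _ ⟨i, rfl⟩ ⟨j, hj⟩
      exact h i j hj.symm
  have hemb : IsOpenMap (Prod.map (Sigma.mk n) (Sigma.mk m) :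
      Tuples d n × Tuples d m → (Σ n : ℕ, Tuples d n) × (Σ n : ℕ, Tuples d n)) :=
    isOpenMap_sigmaMk.prodMap isOpenMap_sigmaMk
  refine Filter.mem_of_superset
    ((hemb _ hT).mem_nhds ⟨(x, y), (hdisj x y).1 hxy, rfl⟩) ?_
  rintro _ ⟨⟨x', y'⟩, h, rfl⟩
  exact (hdisj x' y').2 h

/-- The image `m^{(n)}` on `Γ₀` of the Lebesgue measure `dx₁ … dxₙ` under
`(x₁, …, xₙ) ↦ {x₁, …, xₙ}`. For `n = 0` it is the unit mass at the empty configuration. -/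
def confMeasure (d n : ℕ) : Measure (Conf d) :=
  ((volume : Measure (Fin n → Pt d)).comap (Subtype.val : Tuples d n → Fin n → Pt d)).map toConf

/-- The Lebesgue--Poisson measure `λ_z = ∑ₙ (zⁿ / n!) m^{(n)}` on `Γ₀`. -/
def lebesguePoisson (d : ℕ) (z : ℝ) : Measure (Conf d) :=
  Measure.sum fun n : ℕ => ENNReal.ofReal (z ^ n / (n.factorial : ℝ)) • confMeasure d n

/-- The measure `λ_z² = λ_z ⊗ λ_z` on `Γ₀²`. -/
def lebesguePoisson2 (d : ℕ) (z : ℝ) : Measure (Conf2 d) :=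
  ((lebesguePoisson d z).prod (lebesguePoisson d z)).comap Subtype.val

/-- The Banach space `𝓛_C = L¹(Γ₀², λ_C²)`. -/
abbrev LC (d : ℕ) (C : ℝ) : Type := Lp ℝ 1 (lebesguePoisson2 d C)

/-- The norm of `𝓛_C`, with value in `[0, ∞]`. -/
def normLC {d : ℕ} (C : ℝ) (F : Conf2 d → ℝ) : ℝ≥0∞ := eLpNorm F 1 (lebesguePoisson2 d C)

/-- The set `Γ_Λ^{(n,m)}` of `(η⁺, η⁻) ∈ Γ₀²` with `η^± ⊆ Λ`, `|η⁺| = n` and `|η⁻| = m`. -/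
def confIn {d : ℕ} (Λ : Set (Pt d)) (n m : ℕ) : Set (Conf2 d) :=
  {η | (η.1.1.pts : Set (Pt d)) ⊆ Λ ∧ (η.1.2.pts : Set (Pt d)) ⊆ Λ ∧
    η.1.1.pts.card = n ∧ η.1.2.pts.card = m}

open scoped Classical in
/-- The value `F(a, b)` of a function `F` on `Γ₀²`, where `a` and `b` are finite sets (read as
`0` if they are not disjoint). -/
def val {d : ℕ} (F : Conf2 d → ℝ) (a b : Finset (Pt d)) : ℝ :=
  if h : Disjoint a b then F ⟨(⟨a⟩, ⟨b⟩), h⟩ else 0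

open scoped Classical in
/-- The inverse two-component `K`-transform
`∑_{ξ⁺ ⊆ η⁺} ∑_{ξ⁻ ⊆ η⁻} (-1)^{|η⁺ \ ξ⁺| + |η⁻ \ ξ⁻|} F(ξ⁺, ξ⁻)`. -/
def invK {d : ℕ} (F : Finset (Pt d) → Finset (Pt d) → ℝ) (p q : Finset (Pt d)) : ℝ :=
  ∑ p' ∈ p.powerset, ∑ q' ∈ q.powerset, (-1) ^ ((p \ p').card + (q \ q').card) * F p' q'

open scoped Classical in
/-- For a rate `r(x, γ⁺, γ⁻)`, the function
`R(x, ξ⁺, ξ⁻, η⁺, η⁻) = (𝕂⁻¹ r(x, · ∪ ξ⁺, · ∪ ξ⁻))(η⁺, η⁻)`. This gives `D^±` from `d^±` and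
`B^±` from `b^±`. -/
def rateK {d : ℕ} (r : Pt d → Conf2 d → ℝ) (x : Pt d) (a b p q : Finset (Pt d)) : ℝ :=
  invK (fun p' q' => val (r x) (p' ∪ a) (q' ∪ b)) p q

/-- The standing assumptions on a birth or death rate. -/
structure IsRate {d : ℕ} (r : Pt d → Conf2 d → ℝ) : Prop where
  nonneg : ∀ x η, 0 ≤ r x η
  measurable : Measurable (Function.uncurry r)
  locallyIntegrable : ∀ η, LocallyIntegrable (fun x => r x η) volume

/-- The four rates of a two-component birth-and-death dynamics: death and birth rates `d⁺, b⁺`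
of `+`-particles and `d⁻, b⁻` of `-`-particles. -/
structure Rates (d : ℕ) where
  dp : Pt d → Conf2 d → ℝ
  bp : Pt d → Conf2 d → ℝ
  dm : Pt d → Conf2 d → ℝ
  bm : Pt d → Conf2 d → ℝ
  dp_isRate : IsRate dp
  bp_isRate : IsRate bp
  dm_isRate : IsRate dm
  bm_isRate : IsRate bm

open scoped Classical in
/-- The right-hand side of the formula for `(L̂G)(η⁺, η⁻)`. -/
def LhatExpr {d : ℕ} (R : Rates d) (G : Conf2 d → ℝ) (η : Conf2 d) : ℝ :=
  - (∑ p ∈ η.1.1.pts.powerset, ∑ q ∈ η.1.2.pts.powerset,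
      val G p q * ∑ x ∈ p, rateK R.dp x (p \ {x}) q (η.1.1.pts \ p) (η.1.2.pts \ q))
  + (∑ p ∈ η.1.1.pts.powerset, ∑ q ∈ η.1.2.pts.powerset,
      ∫ x : Pt d, val G (p ∪ {x}) q * rateK R.bp x p q (η.1.1.pts \ p) (η.1.2.pts \ q))
  - (∑ p ∈ η.1.1.pts.powerset, ∑ q ∈ η.1.2.pts.powerset,
      val G p q * ∑ y ∈ q, rateK R.dm y p (q \ {y}) (η.1.1.pts \ p) (η.1.2.pts \ q))
  + (∑ p ∈ η.1.1.pts.powerset, ∑ q ∈ η.1.2.pts.powerset,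
      ∫ y : Pt d, val G p (q ∪ {y}) * rateK R.bm y p q (η.1.1.pts \ p) (η.1.2.pts \ q))

open scoped Classical in
/-- The right-hand side of the formula for `L̂G` is well-defined at `η`: all integrals in it
converge absolutely (all sums in it are finite). -/
def LhatDefinedAt {d : ℕ} (R : Rates d) (G : Conf2 d → ℝ) (η : Conf2 d) : Prop :=
  ∀ p ⊆ η.1.1.pts, ∀ q ⊆ η.1.2.pts,
    Integrable (fun x : Pt d =>
      val G (p ∪ {x}) q * rateK R.bp x p q (η.1.1.pts \ p) (η.1.2.pts \ q)) volume ∧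
    Integrable (fun y : Pt d =>
      val G p (q ∪ {y}) * rateK R.bm y p q (η.1.1.pts \ p) (η.1.2.pts \ q)) volume

/-- `N` is integrable over all `Γ_Λ^{(n,m)}` with `n, m ≥ 1` and `Λ` a bounded Borel set. -/
def LocallyIntegrableBound {d : ℕ} (N : Conf2 d → ℝ) : Prop :=
  ∀ n m : ℕ, 1 ≤ n → 1 ≤ m → ∀ Λ : Set (Pt d), MeasurableSet Λ → Bornology.IsBounded Λ →
    IntegrableOn N (confIn Λ n m) (lebesguePoisson2 d 1)

open scoped Classical in
/-- The sum over the points of `η` of the `𝓛_C`-norms of `D^±` and of `1/C` times the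
`𝓛_C`-norms of `B^±`. -/
def rateNormSum {d : ℕ} (R : Rates d) (C : ℝ) (η : Conf2 d) : ℝ≥0∞ :=
  (∑ x ∈ η.1.1.pts,
    normLC C fun ζ => rateK R.dp x (η.1.1.pts \ {x}) η.1.2.pts ζ.1.1.pts ζ.1.2.pts)
  + ENNReal.ofReal (1 / C) * (∑ x ∈ η.1.1.pts,
    normLC C fun ζ => rateK R.bp x (η.1.1.pts \ {x}) η.1.2.pts ζ.1.1.pts ζ.1.2.pts)
  + (∑ y ∈ η.1.2.pts,
    normLC C fun ζ => rateK R.dm y η.1.1.pts (η.1.2.pts \ {y}) ζ.1.1.pts ζ.1.2.pts)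
  + ENNReal.ofReal (1 / C) * (∑ y ∈ η.1.2.pts,
    normLC C fun ζ => rateK R.bm y η.1.1.pts (η.1.2.pts \ {y}) ζ.1.1.pts ζ.1.2.pts)

/-- For almost all `η`, the sum of norms `rateNormSum` is at most `N(η)`. -/
def RatesBoundedBy {d : ℕ} (R : Rates d) (C : ℝ) (N : Conf2 d → ℝ) : Prop :=
  ∀ᵐ η ∂(lebesguePoisson2 d 1), 0 ≤ N η ∧ rateNormSum R C η ≤ ENNReal.ofReal (N η)

/-- The domain `𝓓 = {G ∈ 𝓛_C : N G ∈ 𝓛_C}`. -/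
def domainD {d : ℕ} (N : Conf2 d → ℝ) (C : ℝ) : Submodule ℝ (LC d C) where
  carrier := {G | MemLp (fun η => N η * G η) 1 (lebesguePoisson2 d C)}
  zero_mem' := by
    refine (MemLp.zero' (ε := ℝ)).ae_eq ?_
    filter_upwards [Lp.coeFn_zero ℝ 1 (lebesguePoisson2 d C)] with η h
    change (0 : ℝ) = N η * (0 : LC d C) η
    rw [h, Pi.zero_apply, mul_zero]
  add_mem' := by
    intro G H hG hH
    refine (hG.add hH).ae_eq ?_
    filter_upwards [Lp.coeFn_add G H] with η h
    change N η * G η + N η * H η = N η * (G + H : LC d C) η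
    rw [h, Pi.add_apply, mul_add]
  smul_mem' := by
    intro c G hG
    refine (hG.const_smul c).ae_eq ?_
    filter_upwards [Lp.coeFn_smul c G] with η h
    change c * (N η * G η) = N η * (c • G : LC d C) η
    rw [h, Pi.smul_apply, smul_eq_mul, mul_left_comm]

end BirthDeath

end

open BirthDeath

/-! Write `λ` for the Lebesgue–Poisson measure with parameter `C`. The estimate rests on two
identities for nonnegative measurable functions. First, the `λ`-integral of `∑_{ξ ⊆ η} H(ξ, η \ ξ)`
is the double integral of `H`, because `Cⁿ/n! · (n choose k) = Cᵏ/k! · Cⁿ⁻ᵏ/(n-k)!`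
(`lintegral_sum_powerset`). Second, its special case `|ξ| = 1` is the Mecke formula
(`lintegral_sum_points`).

Put absolute values inside every term of `L̂G`. The first identity, used in both components,
integrates out `η \ ξ` and turns each `D` or `B` into its `𝓛_C`-norm. A death term becomes the
integral of `|G(ξ)| ∑ ‖D‖`. A birth term becomes an integral over `ξ` and `x` of `|G(ξ ∪ x)| ‖B(x,
ξ)‖`, and the Mecke formula read backwards absorbs `x` into `ξ` at the price of a factor `1/C`.
Hence the integral of `majorant` is exactly that of `|G| · rateNormSum` (`lintegral_majorant`),
which is at most `‖NG‖`. This one bound gives almost sure absolute convergence, integrability of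
`L̂G` and the norm inequality.

Changing `G` on a null set is harmless by the same identities with constant kernel `1`: almost no
`η` has a subconfiguration in a null set, nor a positive-measure set of one-point additions leading
into it (`ae_subconf_eq_zero`). The domain is dense because cutting `G` off to `{|N| ≤ n}`
approximates it.

All of this needs joint measurability on `Γ₀` with its quotient Borel structure. It is obtained by
listing configurations in increasing order: a Lusin–Souslin argument shows that the Borel sets are
generated by hitting events, and it provides a measurable enumeration (`borel_le_hitSpace`,
`exists_measurable_enum`). The assumption `d ≥ 1` makes diagonals null, so that tuples may be taken
injective and pairs of configurations disjoint. -/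

noncomputable section

namespace BirthDeath

/-! ### Sorted enumerations and the Borel structure of `Γ₀` -/

open scoped Classical in
/-- The configuration formed by the first `n` terms of a sequence. -/
def seqConf {d : ℕ} (w : ℕ × (ℕ → Pt d)) : Conf d :=
  ⟨(Finset.range w.1).image w.2⟩

theorem mem_seqConf {d : ℕ} (w : ℕ × (ℕ → Pt d)) (y : Pt d) :
    y ∈ (seqConf w).pts ↔ ∃ i < w.1, w.2 i = y := by
  simp [seqConf]

/-- The configurations that have a point in `U`. -/
def hitSet {d : ℕ} (U : Set (Pt d)) : Set (Conf d) := {η | ∃ y ∈ η.pts, y ∈ U}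

/-- The `σ`-algebra generated by the sets of configurations hitting a basic open set. -/
abbrev hitSpace (d : ℕ) : MeasurableSpace (Conf d) :=
  MeasurableSpace.generateFrom
    (Set.range fun U : TopologicalSpace.countableBasis (Pt d) => hitSet (U : Set (Pt d)))

/-- Sequences that enumerate a finite configuration increasingly (for a Borel embedding of
`ℝ^d` in `ℝ`) and vanish afterwards. -/
def sortedSeq (d : ℕ) : Set (ℕ × (ℕ → Pt d)) :=
  {w | (∀ i j, i < j → j < w.1 → embeddingReal (Pt d) (w.2 i) < embeddingReal (Pt d) (w.2 j)) ∧
    ∀ i, w.1 ≤ i → w.2 i = 0}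

theorem injOn_of_mem_sortedSeq {d : ℕ} {w : ℕ × (ℕ → Pt d)} (hw : w ∈ sortedSeq d) {i j : ℕ}
    (hi : i < w.1) (hj : j < w.1) (h : w.2 i = w.2 j) : i = j := by
  rcases lt_trichotomy i j with hij | hij | hij
  · exact absurd (hw.1 i j hij hj) (by rw [h]; exact lt_irrefl _)
  · exact hij
  · exact absurd (hw.1 j i hij hi) (by rw [h]; exact lt_irrefl _)

theorem card_seqConf {d : ℕ} {w : ℕ × (ℕ → Pt d)} (hw : w ∈ sortedSeq d) :
    (seqConf w).pts.card = w.1 := by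
  rw [seqConf, Finset.card_image_of_injOn, Finset.card_range]
  intro i hi j hj h
  exact injOn_of_mem_sortedSeq hw (by simpa using hi) (by simpa using hj) h

theorem measurableSet_sortedSeq (d : ℕ) : MeasurableSet (sortedSeq d) := by
  have he := (measurableEmbedding_embeddingReal (Pt d)).measurable
  have hx : ∀ i, Measurable fun w : ℕ × (ℕ → Pt d) => w.2 i := fun i =>
    (measurable_pi_apply i).comp measurable_snd
  simp only [sortedSeq, Set.ofPred_and, Set.ofPred_forall]
  refine MeasurableSet.inter ?_ ?_
  · refine MeasurableSet.iInter fun i => MeasurableSet.iInter fun j =>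
      MeasurableSet.iInter fun _ => ?_
    have : {w : ℕ × (ℕ → Pt d) | j < w.1 →
        embeddingReal (Pt d) (w.2 i) < embeddingReal (Pt d) (w.2 j)} =
        {w | w.1 ≤ j} ∪ {w | embeddingReal (Pt d) (w.2 i) < embeddingReal (Pt d) (w.2 j)} := by
      ext w
      simp only [Set.mem_union, Set.mem_ofPred_eq, ← not_lt, imp_iff_not_or]
    rw [this]
    exact (measurable_fst (measurableSet_Iic (a := j))).union
      (measurableSet_lt (he.comp (hx i)) (he.comp (hx j)))
  · refine MeasurableSet.iInter fun i => ?_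
    have : {w : ℕ × (ℕ → Pt d) | w.1 ≤ i → w.2 i = 0} =
        {w | i < w.1} ∪ {w | w.2 i = 0} := by
      ext w
      simp only [Set.mem_union, Set.mem_ofPred_eq, ← not_lt, imp_iff_not_or, not_not]
    rw [this]
    exact (measurable_fst (measurableSet_Ioi (a := i))).union
      ((hx i) (measurableSet_singleton (0 : Pt d)))

/-- The hypothesis of Lusin–Souslin: an injective measurable map from a standard Borel space into a
countably separated space is a measurable embedding. -/
instance instStandardBorelSortedSeq (d : ℕ) : StandardBorelSpace (sortedSeq d) :=
  (measurableSet_sortedSeq d).standardBorel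

theorem seqConf_surjective (d : ℕ) (η : Conf d) : ∃ w ∈ sortedSeq d, seqConf w = η := by
  -- The order of `ℝ`, pulled back along the Borel embedding, selects one enumeration of each finite
  -- set.
  let _ : LinearOrder (Pt d) := LinearOrder.lift' (embeddingReal (Pt d))
    (measurableEmbedding_embeddingReal (Pt d)).injective
  let f := η.pts.orderEmbOfFin rfl
  refine ⟨(η.pts.card, fun i => if h : i < η.pts.card then f ⟨i, h⟩ else 0), ⟨?_, ?_⟩, ?_⟩
  · intro i j hij hj
    simp only at hj
    have hi := hij.trans hj
    simp only [hi, hj, dif_pos]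
    have : f ⟨i, hi⟩ < f ⟨j, hj⟩ := f.strictMono hij
    exact this
  · intro i hi
    simp only at hi
    simp [not_lt.2 hi]
  · ext y
    rw [mem_seqConf]
    have hr : y ∈ η.pts ↔ y ∈ Set.range f := by
      rw [Finset.range_orderEmbOfFin]; rfl
    rw [hr]
    constructor
    · rintro ⟨i, hi, rfl⟩
      simp only at hi
      exact ⟨⟨i, hi⟩, by simp [hi]⟩
    · rintro ⟨i, rfl⟩
      exact ⟨i, i.2, by simp⟩

theorem seqConf_injOn (d : ℕ) : Set.InjOn (seqConf (d := d)) (sortedSeq d) := by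
  rintro ⟨n, x⟩ hx ⟨m, y⟩ hy h
  have hnm : n = m := by
    have := card_seqConf hx
    rw [h, card_seqConf hy] at this
    exact this.symm
  subst hnm
  have he := (measurableEmbedding_embeddingReal (Pt d)).injective
  have key : (fun i : Fin n => embeddingReal (Pt d) (x i)) =
      fun i : Fin n => embeddingReal (Pt d) (y i) := by
    refine (StrictMono.range_inj (fun (i j : Fin n) hij => hx.1 i j hij j.2)
      (fun (i j : Fin n) hij => hy.1 i j hij j.2)).1 ?_
    have hpt : ∀ z : Pt d, (∃ i < n, x i = z) ↔ ∃ i < n, y i = z := by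
      intro z
      rw [← mem_seqConf (n, x), h, mem_seqConf]
    ext t
    constructor
    · rintro ⟨i, rfl⟩
      obtain ⟨j, hj, hji⟩ := (hpt (x i)).1 ⟨i, i.2, rfl⟩
      exact ⟨⟨j, hj⟩, congrArg _ hji⟩
    · rintro ⟨i, rfl⟩
      obtain ⟨j, hj, hji⟩ := (hpt (y i)).2 ⟨i, i.2, rfl⟩
      exact ⟨⟨j, hj⟩, congrArg _ hji⟩
  -- Below `n` the increasing enumeration of a finite set is unique; from `n` on both sequences
  -- vanish, which is why the padding is prescribed in `sortedSeq`.
  refine Prod.ext rfl (funext fun i => ?_)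
  by_cases hi : i < n
  · exact he (congrFun key ⟨i, hi⟩)
  · exact (hx.2 i (not_lt.1 hi)).trans (hy.2 i (not_lt.1 hi)).symm

theorem isOpen_injective (d n : ℕ) : IsOpen {x : Fin n → Pt d | Function.Injective x} := by
  have : {x : Fin n → Pt d | Function.Injective x} = ⋂ i, ⋂ j, {x | i ≠ j → x i ≠ x j} := by
    ext x
    simp only [Set.mem_ofPred_eq, Set.mem_iInter, Function.Injective]
    exact ⟨fun h i j hij e => hij (h e), fun h i j e => by_contra fun hij => h i j hij e⟩
  rw [this]
  refine isOpen_iInter_of_finite fun i => isOpen_iInter_of_finite fun j => ?_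
  by_cases hij : i = j
  · simp [hij]
  · simpa [hij] using isOpen_ne_fun (continuous_apply i) (continuous_apply j)

/-- `seqConf` on the sorted sequences is Borel measurable. -/
theorem measurable_seqConf_sortedSeq (d : ℕ) :
    Measurable fun w : sortedSeq d => seqConf (w : ℕ × (ℕ → Pt d)) := by
  intro B hB
  have hset : MeasurableSet
      {w : ℕ × (ℕ → Pt d) | Function.Injective (fun i : Fin w.1 => w.2 i) ∧ seqConf w ∈ B} := by
    have : ∀ n, MeasurableSet
        {x : ℕ → Pt d | Function.Injective (fun i : Fin n => x i) ∧ seqConf (n, x) ∈ B} := by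
      intro n
      -- For fixed length, `toConf` is continuous on the injective tuples, which form an open set.
      -- On sorted sequences injectivity is automatic, so the extra condition in `hset` disappears
      -- at the end.
      have h1 : MeasurableSet
          ((Subtype.val : Tuples d n → Fin n → Pt d) '' (toConf ⁻¹' B)) :=
        (isOpen_injective d n).measurableSet.subtype_image (continuous_toConf.measurable hB)
      have h2 : Measurable fun (x : ℕ → Pt d) (i : Fin n) => x i :=
        measurable_pi_lambda _ fun i => measurable_pi_apply _
      convert h2 h1 using 1
      ext x
      have hc : ∀ h : Function.Injective fun i : Fin n => x i,
          seqConf (n, x) = toConf (⟨fun i : Fin n => x i, h⟩ : Tuples d n) := by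
        intro h
        ext y
        rw [mem_seqConf, mem_toConf]
        exact ⟨fun ⟨i, hi, e⟩ => ⟨⟨i, hi⟩, e⟩, fun ⟨i, e⟩ => ⟨i, i.2, e⟩⟩
      simp only [Set.mem_ofPred_eq, Set.mem_preimage, Set.mem_image]
      constructor
      · rintro ⟨h, hB⟩
        exact ⟨⟨_, h⟩, by rwa [← hc h], rfl⟩
      · rintro ⟨⟨y, hy⟩, hyB, rfl⟩
        exact ⟨hy, by rwa [hc hy]⟩
    have hu : {w : ℕ × (ℕ → Pt d) | Function.Injective (fun i : Fin w.1 => w.2 i) ∧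
        seqConf w ∈ B} = ⋃ n, ({n} : Set ℕ) ×ˢ
          {x : ℕ → Pt d | Function.Injective (fun i : Fin n => x i) ∧ seqConf (n, x) ∈ B} := by
      ext ⟨n, x⟩
      simp
    rw [hu]
    exact MeasurableSet.iUnion fun n => (measurableSet_singleton n).prod (this n)
  convert measurable_subtype_coe hset using 1
  ext ⟨w, hw⟩
  simp only [Set.mem_preimage, Set.mem_ofPred_eq, iff_and_self]
  intro _ i j h
  exact Fin.ext (injOn_of_mem_sortedSeq hw i.2 j.2 h)

theorem measurable_to_hitSpace {d : ℕ} {X : Type*} [MeasurableSpace X] {f : X → Conf d}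
    (hf : ∀ U, IsOpen U → MeasurableSet {x | ∃ y ∈ (f x).pts, y ∈ U}) :
    @Measurable _ _ _ (hitSpace d) f := by
  refine measurable_generateFrom ?_
  rintro _ ⟨⟨U, hU⟩, rfl⟩
  exact hf U ((TopologicalSpace.isBasis_countableBasis _).isOpen hU)

theorem isOpen_hitSet {d : ℕ} {U : Set (Pt d)} (hU : IsOpen U) : IsOpen (hitSet U) := by
  rw [isOpen_coinduced, isOpen_sigma_iff]
  intro n
  have : Sigma.mk n ⁻¹' (sigmaToConf d ⁻¹' hitSet U) =
      ⋃ i, {x : Tuples d n | x.1 i ∈ U} := by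
    ext x
    simp only [Set.mem_preimage, hitSet, sigmaToConf, mem_toConf, Set.mem_ofPred_eq,
      Set.mem_iUnion]
    exact ⟨fun ⟨_, ⟨i, e⟩, hy⟩ => ⟨i, e ▸ hy⟩, fun ⟨i, h⟩ => ⟨_, ⟨i, rfl⟩, h⟩⟩
  rw [this]
  exact isOpen_iUnion fun i =>
    hU.preimage ((continuous_apply i).comp continuous_subtype_val)

theorem measurableSet_exists_seqConf {d : ℕ} {U : Set (Pt d)} (hU : IsOpen U) :
    MeasurableSet {w : ℕ × (ℕ → Pt d) | ∃ y ∈ (seqConf w).pts, y ∈ U} := by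
  have : {w : ℕ × (ℕ → Pt d) | ∃ y ∈ (seqConf w).pts, y ∈ U} =
      ⋃ i, {w | i < w.1} ∩ {w | w.2 i ∈ U} := by
    ext w
    simp only [mem_seqConf, Set.mem_ofPred_eq, Set.mem_iUnion, Set.mem_inter_iff]
    exact ⟨fun ⟨_, ⟨i, hi, e⟩, hy⟩ => ⟨i, hi, e ▸ hy⟩, fun ⟨i, hi, h⟩ => ⟨_, ⟨i, hi, rfl⟩, h⟩⟩
  rw [this]
  exact MeasurableSet.iUnion fun i => (measurableSet_lt measurable_const measurable_fst).inter
    (((measurable_pi_apply i).comp measurable_snd) hU.measurableSet)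

/-- A point of `η` outside the finite, hence closed, set `ξ` has a basic neighbourhood that misses
`ξ`. Thus countably many hitting events determine a configuration. -/
theorem countablySeparated_hitSpace (d : ℕ) :
    @MeasurableSpace.CountablySeparated (Conf d) (hitSpace d) := by
  let _ := hitSpace d
  have : MeasurableSpace.CountablyGenerated (Conf d) :=
    ⟨_, have := (TopologicalSpace.countable_countableBasis (Pt d)).to_subtype
      Set.countable_range _, rfl⟩
  have : MeasurableSpace.SeparatesPoints (Conf d) := by
    refine ⟨fun η ξ h => ?_⟩
    have hh : ∀ U ∈ TopologicalSpace.countableBasis (Pt d), η ∈ hitSet U ↔ ξ ∈ hitSet U := by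
      intro U hU
      have hm : MeasurableSet (hitSet U) :=
        MeasurableSpace.measurableSet_generateFrom ⟨⟨U, hU⟩, rfl⟩
      exact ⟨h _ hm, fun hξ => by_contra fun hη => h _ hm.compl hη hξ⟩
    have aux : ∀ η ξ : Conf d, (∀ U ∈ TopologicalSpace.countableBasis (Pt d),
        η ∈ hitSet U → ξ ∈ hitSet U) → η.pts ⊆ ξ.pts := by
      intro η ξ h y hy
      by_contra hyξ
      obtain ⟨U, hU, hyU, hUs⟩ :=
        (TopologicalSpace.isBasis_countableBasis (Pt d)).exists_subset_of_mem_open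
          (show y ∈ ((ξ.pts : Set (Pt d)))ᶜ from hyξ) ξ.pts.finite_toSet.isClosed.isOpen_compl
      obtain ⟨z, hz, hzU⟩ := h U hU ⟨y, hy, hyU⟩
      exact hUs hzU hz
    exact Conf.ext (Finset.Subset.antisymm (aux η ξ fun U hU => (hh U hU).1)
      (aux ξ η fun U hU => (hh U hU).2))
  infer_instance

/-- Lusin–Souslin for the coarser `σ`-algebra. Comparing it with Borel measurability of the same
bijection identifies the two `σ`-algebras. -/
theorem measurableEmbedding_seqConf_hitSpace (d : ℕ) :
    @MeasurableEmbedding _ _ _ (hitSpace d)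
      fun w : sortedSeq d => seqConf (w : ℕ × (ℕ → Pt d)) := by
  let _ := hitSpace d
  have := countablySeparated_hitSpace d
  refine Measurable.measurableEmbedding ?_ ?_
  · exact measurable_to_hitSpace fun U hU =>
      measurable_subtype_coe (measurableSet_exists_seqConf hU)
  · exact fun w w' h => Subtype.ext (seqConf_injOn d w.2 w'.2 h)

/-- The Borel `σ`-algebra of `Γ₀` is generated by the sets of configurations hitting a basic
open set. -/
theorem borel_le_hitSpace (d : ℕ) : instMeasurableSpaceConf d ≤ hitSpace d := by
  intro B hB
  -- The sorted sequences lying over `B` form a measurable set, whose image belongs to the hit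
  -- `σ`-algebra; by surjectivity the image is `B`.
  have h := @MeasurableEmbedding.measurableSet_image' _ _ _ (hitSpace d) _
    (measurableEmbedding_seqConf_hitSpace d) _ (measurable_seqConf_sortedSeq d hB)
  rwa [Set.image_preimage_eq] at h
  intro η
  obtain ⟨w, hw, h⟩ := seqConf_surjective d η
  exact ⟨⟨w, hw⟩, h⟩

/-- A map into `Γ₀` is measurable if the sets of arguments whose image hits `U` are
measurable for all open `U`. -/
theorem measurable_conf_of_hit {d : ℕ} {X : Type*} [MeasurableSpace X] {f : X → Conf d}
    (hf : ∀ U, IsOpen U → MeasurableSet {x | ∃ y ∈ (f x).pts, y ∈ U}) : Measurable f :=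
  fun _ hB => measurable_to_hitSpace hf (borel_le_hitSpace d _ hB)

theorem exists_measurable_enum (d : ℕ) :
    ∃ s : Conf d → ℕ × (ℕ → Pt d), Measurable s ∧ ∀ η, s η ∈ sortedSeq d ∧ seqConf (s η) = η := by
  have := (countablySeparated_hitSpace d)
  have hle : hitSpace d ≤ instMeasurableSpaceConf d := by
    refine MeasurableSpace.generateFrom_le ?_
    rintro _ ⟨⟨U, hU⟩, rfl⟩
    exact (isOpen_hitSet
      ((TopologicalSpace.isBasis_countableBasis _).isOpen hU)).measurableSet
  have : MeasurableSpace.CountablySeparated (Conf d) :=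
    MeasurableSpace.CountablySeparated.mono (hsep := this) hle
  have hemb : MeasurableEmbedding fun w : sortedSeq d => seqConf (w : ℕ × (ℕ → Pt d)) :=
    (measurable_seqConf_sortedSeq d).measurableEmbedding
      fun w w' h => Subtype.ext (seqConf_injOn d w.2 w'.2 h)
  -- Extending the inclusion of the sorted sequences along the embedding gives a measurable inverse
  -- of `seqConf`, since the embedding is onto.
  obtain ⟨s, hs, hsf⟩ := hemb.exists_measurable_extend
    (measurable_subtype_coe (p := fun w => w ∈ sortedSeq d)) (fun _ => ⟨(0, fun _ => 0)⟩)
  refine ⟨s, hs, fun η => ?_⟩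
  obtain ⟨w, hw, rfl⟩ := seqConf_surjective d η
  have : s (seqConf w) = w := congrFun hsf ⟨w, hw⟩
  rw [this]
  exact ⟨hw, rfl⟩

/-- A measurable enumeration of the points of a configuration. -/
def enum {d : ℕ} : Conf d → ℕ × (ℕ → Pt d) := (exists_measurable_enum d).choose

theorem measurable_enum {d : ℕ} : Measurable (enum (d := d)) :=
  (exists_measurable_enum d).choose_spec.1

theorem enum_mem {d : ℕ} (η : Conf d) : enum η ∈ sortedSeq d :=
  ((exists_measurable_enum d).choose_spec.2 η).1

theorem seqConf_enum {d : ℕ} (η : Conf d) : seqConf (enum η) = η :=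
  ((exists_measurable_enum d).choose_spec.2 η).2

/-! ### Measurability of operations on configurations -/

open scoped Classical in
theorem measurable_image_conf {d : ℕ} {ι X : Type*} [MeasurableSpace X] (I : Finset ι)
    {f : X → ι → Pt d} (hf : ∀ i, Measurable fun x => f x i) :
    Measurable fun x => (⟨I.image (f x)⟩ : Conf d) := by
  refine measurable_conf_of_hit fun U hU => ?_
  have : {x | ∃ y ∈ I.image (f x), y ∈ U} = ⋃ i ∈ I, {x | f x i ∈ U} := by
    ext x
    simp
  rw [this]
  exact I.measurableSet_biUnion fun i _ => hf i hU.measurableSet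

open scoped Classical in
theorem measurable_union_conf {d : ℕ} {X : Type*} [MeasurableSpace X] {f g : X → Conf d}
    (hf : Measurable f) (hg : Measurable g) :
    Measurable fun x => (⟨(f x).pts ∪ (g x).pts⟩ : Conf d) := by
  have hU : ∀ U : Set (Pt d), IsOpen U → MeasurableSet (hitSet U) := fun U hU => by
    refine IsOpen.measurableSet ?_
    exact isOpen_hitSet hU
  refine measurable_conf_of_hit fun U hUo => ?_
  have : {x | ∃ y ∈ (f x).pts ∪ (g x).pts, y ∈ U} = f ⁻¹' hitSet U ∪ g ⁻¹' hitSet U := by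
    ext x
    simp only [Finset.mem_union, or_and_right, exists_or]
    rfl
  rw [this]
  exact (hf (hU U hUo)).union (hg (hU U hUo))

theorem measurable_singleton_conf {d : ℕ} : Measurable fun x : Pt d => (⟨{x}⟩ : Conf d) := by
  refine measurable_conf_of_hit fun U hU => ?_
  simpa using hU.measurableSet

theorem card_enum {d : ℕ} (η : Conf d) : η.pts.card = (enum η).1 := by
  conv_lhs => rw [← seqConf_enum η]
  exact card_seqConf (enum_mem η)

theorem measurable_card {d : ℕ} : Measurable fun η : Conf d => η.pts.card := by
  simp only [card_enum]
  exact measurable_fst.comp measurable_enum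

open scoped Classical in
theorem pts_eq_image_enum {d : ℕ} (η : Conf d) :
    η.pts = (Finset.range (enum η).1).image (enum η).2 :=
  (congrArg Conf.pts (seqConf_enum η)).symm

theorem enum_injOn {d : ℕ} (η : Conf d) :
    Set.InjOn (enum η).2 (Finset.range (enum η).1) := by
  intro i hi j hj h
  exact injOn_of_mem_sortedSeq (enum_mem η) (by simpa using hi) (by simpa using hj) h

theorem measurable_enum_apply {d : ℕ} {X : Type*} [MeasurableSpace X] {f : X → Conf d}
    (hf : Measurable f) (i : ℕ) : Measurable fun x => (enum (f x)).2 i :=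
  (measurable_pi_apply i).comp (measurable_snd.comp (measurable_enum.comp hf))

/-- Sums over subsets of an injective image. -/
theorem sum_powerset_image {ι α M : Type*} [DecidableEq ι] [DecidableEq α] [AddCommMonoid M]
    (I : Finset ι) (f : ι → α)
    (hf : Set.InjOn f I) (H : Finset α → Finset α → M) :
    ∑ p ∈ (I.image f).powerset, H p (I.image f \ p) =
      ∑ J ∈ I.powerset, H (J.image f) ((I \ J).image f) := by
  rw [Finset.powerset_image, Finset.sum_image]
  · refine Finset.sum_congr rfl fun J hJ => ?_
    rw [Finset.mem_powerset] at hJ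
    congr 1
    ext y
    simp only [Finset.mem_sdiff, Finset.mem_image]
    constructor
    · rintro ⟨⟨i, hi, rfl⟩, h⟩
      exact ⟨i, ⟨hi, fun hiJ => h ⟨i, hiJ, rfl⟩⟩, rfl⟩
    · rintro ⟨i, ⟨hi, hiJ⟩, rfl⟩
      refine ⟨⟨i, hi, rfl⟩, ?_⟩
      rintro ⟨j, hj, hji⟩
      exact hiJ (hf (hJ hj) hi hji ▸ hj)
  · intro J hJ K hK h
    simp only [Finset.coe_powerset, Set.mem_preimage, Set.mem_powerset_iff, Finset.coe_subset]
      at hJ hK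
    have aux : ∀ J ⊆ I, ∀ K ⊆ I, J.image f = K.image f → J ⊆ K := by
      intro J hJ K hK h i hi
      obtain ⟨k, hk, e⟩ := Finset.mem_image.1 (h ▸ Finset.mem_image_of_mem f hi)
      exact hf (hK hk) (hJ hi) e ▸ hk
    exact Finset.Subset.antisymm (aux J hJ K hK h) (aux K hK J hJ h.symm)

theorem measurable_nat_family {X M : Type*} [MeasurableSpace X] [MeasurableSpace M]
    {k : X → ℕ} (hk : Measurable k) {F : ℕ → X → M} (hF : ∀ n, Measurable (F n)) :
    Measurable fun x => F (k x) x :=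
  (measurable_from_prod_countable_right (f := fun q : ℕ × X => F q.1 q.2) hF).comp
    (hk.prodMk measurable_id)

-- The index set of the sum varies with `x`. Through `enum` it becomes the power set of `range n`,
-- fixed on each of the countably many pieces where `f x` has `n` points.
open scoped Classical in
theorem measurable_sum_powerset {d : ℕ} {X M : Type*} [MeasurableSpace X] [AddCommMonoid M]
    [MeasurableSpace M] [MeasurableAdd₂ M] {f : X → Conf d} (hf : Measurable f)
    {H : X → Conf d → Conf d → M}
    (hH : Measurable fun q : X × Conf d × Conf d => H q.1 q.2.1 q.2.2) :
    Measurable fun x => ∑ p ∈ (f x).pts.powerset, H x ⟨p⟩ ⟨(f x).pts \ p⟩ := by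
  have h : ∀ x, ∑ p ∈ (f x).pts.powerset, H x ⟨p⟩ ⟨(f x).pts \ p⟩ =
      ∑ J ∈ (Finset.range (enum (f x)).1).powerset, H x ⟨J.image (enum (f x)).2⟩
        ⟨(Finset.range (enum (f x)).1 \ J).image (enum (f x)).2⟩ := by
    intro x
    rw [pts_eq_image_enum (f x)]
    exact sum_powerset_image _ _ (enum_injOn _) fun a b => H x ⟨a⟩ ⟨b⟩
  simp only [h]
  refine measurable_nat_family (F := fun n x => ∑ J ∈ (Finset.range n).powerset,
    H x ⟨J.image (enum (f x)).2⟩ ⟨(Finset.range n \ J).image (enum (f x)).2⟩)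
    (measurable_fst.comp (measurable_enum.comp hf)) fun n => ?_
  refine Finset.measurable_sum _ fun J _ => ?_
  exact hH.comp (measurable_id.prodMk ((measurable_image_conf J (measurable_enum_apply hf)).prodMk
    (measurable_image_conf _ (measurable_enum_apply hf))))

open scoped Classical in
theorem measurable_sum_points {d : ℕ} {X M : Type*} [MeasurableSpace X] [AddCommMonoid M]
    [MeasurableSpace M] [MeasurableAdd₂ M] {f : X → Conf d} (hf : Measurable f)
    {H : X → Pt d → Conf d → M}
    (hH : Measurable fun q : X × Pt d × Conf d => H q.1 q.2.1 q.2.2) :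
    Measurable fun x => ∑ y ∈ (f x).pts, H x y ⟨(f x).pts \ {y}⟩ := by
  have h : ∀ x, ∑ y ∈ (f x).pts, H x y ⟨(f x).pts \ {y}⟩ =
      ∑ i ∈ Finset.range (enum (f x)).1, H x ((enum (f x)).2 i)
        ⟨(Finset.range (enum (f x)).1 \ {i}).image (enum (f x)).2⟩ := by
    intro x
    have hI := enum_injOn (f x)
    rw [pts_eq_image_enum (f x), Finset.sum_image hI]
    refine Finset.sum_congr rfl fun i hi => ?_
    congr 2
    ext y
    simp only [Finset.mem_sdiff, Finset.mem_image, Finset.mem_singleton]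
    constructor
    · rintro ⟨⟨j, hj, rfl⟩, hne⟩
      exact ⟨j, ⟨hj, fun e => hne (e ▸ rfl)⟩, rfl⟩
    · rintro ⟨j, ⟨hj, hne⟩, rfl⟩
      exact ⟨⟨j, hj, rfl⟩, fun e => hne (hI (by simpa using hj) (by simpa using hi) e)⟩
  simp only [h]
  refine measurable_nat_family (F := fun n x => ∑ i ∈ Finset.range n,
    H x ((enum (f x)).2 i) ⟨(Finset.range n \ {i}).image (enum (f x)).2⟩)
    (measurable_fst.comp (measurable_enum.comp hf)) fun n => ?_
  refine Finset.measurable_sum _ fun i _ => ?_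
  exact hH.comp (measurable_id.prodMk ((measurable_enum_apply hf i).prodMk
    (measurable_image_conf _ (measurable_enum_apply hf))))

theorem measurableEmbedding_conf2 (d : ℕ) :
    MeasurableEmbedding (Subtype.val : Conf2 d → Conf d × Conf d) :=
  MeasurableEmbedding.subtype_coe (measurableSet_conf2 d)

open scoped Classical in
/-- The values of a family of functions on `Γ₀²` depend measurably on all arguments. -/
theorem measurable_val_family {d : ℕ} {X Z : Type*} [MeasurableSpace X] [MeasurableSpace Z]
    {r : Z → Conf2 d → ℝ}
    (hr : Measurable (Function.uncurry r)) {z : X → Z} (hz : Measurable z) {a b : X → Conf d}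
    (ha : Measurable a) (hb : Measurable b) :
    Measurable fun x => val (r (z x)) (a x).pts (b x).pts := by
  have hs : MeasurableSet {x | Disjoint (a x).pts (b x).pts} :=
    (ha.prodMk hb) (measurableSet_conf2 d)
  refine Measurable.dite (s := {x | Disjoint (a x).pts (b x).pts})
    (f := fun x => r (z x) ⟨(a x, b x), x.2⟩) (g := fun _ => (0 : ℝ)) ?_ measurable_const hs
  exact hr.comp ((hz.comp measurable_subtype_coe).prodMk
    (((ha.prodMk hb).comp measurable_subtype_coe).subtype_mk))

theorem measurable_val {d : ℕ} {X : Type*} [MeasurableSpace X] {F : Conf2 d → ℝ}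
    (hF : Measurable F) {a b : X → Conf d} (ha : Measurable a) (hb : Measurable b) :
    Measurable fun x => val F (a x).pts (b x).pts :=
  measurable_val_family (r := fun _ : Unit => F) (hF.comp measurable_snd)
    (z := fun _ => ()) measurable_const ha hb

/-- The double sum is handled one component at a time; the complements are carried along because the
sign depends on their cardinalities. -/
theorem measurable_rateK {d : ℕ} {X : Type*} [MeasurableSpace X] {r : Pt d → Conf2 d → ℝ}
    (hr : Measurable (Function.uncurry r)) {z : X → Pt d} (hz : Measurable z)
    {a b p q : X → Conf d} (ha : Measurable a) (hb : Measurable b) (hp : Measurable p)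
    (hq : Measurable q) :
    Measurable fun x => rateK r (z x) (a x).pts (b x).pts (p x).pts (q x).pts := by
  unfold rateK invK
  have hcard : Measurable fun c : Conf d => c.pts.card := measurable_card
  refine measurable_sum_powerset hp (H := fun x p' p'' => ∑ q' ∈ (q x).pts.powerset,
    (-1) ^ (p''.pts.card + ((q x).pts \ q').card) *
      val (r (z x)) (p'.pts ∪ (a x).pts) (q' ∪ (b x).pts)) ?_
  refine measurable_sum_powerset (X := X × Conf d × Conf d) (hq.comp measurable_fst)
    (H := fun x q' q'' => (-1) ^ (x.2.2.pts.card + q''.pts.card) *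
      val (r (z x.1)) (x.2.1.pts ∪ (a x.1).pts) (q'.pts ∪ (b x.1).pts)) ?_
  refine Measurable.mul ?_ ?_
  · exact (measurable_from_nat (f := fun n : ℕ => (-1 : ℝ) ^ n)).comp
      ((hcard.comp (by fun_prop)).add (hcard.comp (by fun_prop)))
  · exact measurable_val_family hr (z := fun x : (X × Conf d × Conf d) × Conf d × Conf d =>
      z x.1.1) (by fun_prop) (measurable_union_conf (by fun_prop) (by fun_prop))
      (measurable_union_conf (by fun_prop) (by fun_prop))

/-! ### Integration against Lebesgue–Poisson measures -/

open scoped Classical in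
/-- The configuration formed by the entries of a tuple. -/
def ofTuple {d : ℕ} {ι : Type*} [Fintype ι] (x : ι → Pt d) : Conf d := ⟨Finset.univ.image x⟩

theorem measurable_ofTuple {d : ℕ} {ι : Type*} [Fintype ι] :
    Measurable (ofTuple : (ι → Pt d) → Conf d) :=
  measurable_image_conf Finset.univ fun i => measurable_pi_apply i

theorem ae_injective {d : ℕ} (hd : 1 ≤ d) (ι : Type*) [Fintype ι] :
    ∀ᵐ x : ι → Pt d, Function.Injective x := by
  classical
  have : Nonempty (Fin d) := ⟨⟨0, hd⟩⟩
  obtain ⟨v, hv⟩ := exists_ne (0 : Pt d)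
  have h : ∀ i j : ι, i ≠ j → ∀ᵐ x : ι → Pt d, x i ≠ x j := by
    intro i j hij
    -- The diagonal `x i = x j` is a linear subspace, proper because `v` in slot `i` alone violates
    -- it, hence null. The nonzero `v` exists because `d ≥ 1`.
    let S : Submodule ℝ (ι → Pt d) :=
      LinearMap.ker (LinearMap.proj (R := ℝ) (φ := fun _ : ι => Pt d) i - LinearMap.proj j)
    have hS : S ≠ ⊤ := by
      intro h
      have : Pi.single i v ∈ S := h ▸ Submodule.mem_top
      simp [S, hij.symm] at this
      exact hv this
    have := Measure.addHaar_submodule volume S hS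
    rw [ae_iff]
    convert this using 2
    ext x
    simp [S, sub_eq_zero]
  have h' : ∀ᵐ x : ι → Pt d, ∀ i j, i ≠ j → x i ≠ x j := by
    rw [ae_all_iff]; intro i; rw [ae_all_iff]; intro j
    by_cases hij : i = j
    · exact Filter.Eventually.of_forall fun _ h => absurd hij h
    · filter_upwards [h i j hij] with x hx _ using hx
  filter_upwards [h'] with x hx i j e
  by_contra hij
  exact hx i j hij e

theorem confMeasure_eq_map (d n : ℕ) :
    confMeasure d n = ((volume : Measure (Fin n → Pt d)).restrict
      {x | Function.Injective x}).map ofTuple := by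
  have hc : (toConf : Tuples d n → Conf d) = ofTuple ∘ Subtype.val := funext fun x => by
    ext y
    simp [mem_toConf, ofTuple]
  have hemb : MeasurableEmbedding (Subtype.val : Tuples d n → Fin n → Pt d) :=
    MeasurableEmbedding.subtype_coe (isOpen_injective d n).measurableSet
  rw [confMeasure, hc, ← Measure.map_map measurable_ofTuple measurable_subtype_coe,
    hemb.map_comap, Subtype.range_coe_subtype]

theorem lintegral_confMeasure {d : ℕ} (hd : 1 ≤ d) (n : ℕ) {F : Conf d → ℝ≥0∞}
    (hF : Measurable F) :
    ∫⁻ η, F η ∂(confMeasure d n) = ∫⁻ x : Fin n → Pt d, F (ofTuple x) := by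
  rw [confMeasure_eq_map, lintegral_map hF measurable_ofTuple,
    Measure.restrict_eq_self_of_ae_mem (s := {x | Function.Injective x})
      (ae_injective hd (Fin n))]

theorem lintegral_lebesguePoisson {d : ℕ} (hd : 1 ≤ d) (z : ℝ) {F : Conf d → ℝ≥0∞}
    (hF : Measurable F) :
    ∫⁻ η, F η ∂(lebesguePoisson d z) =
      ∑' n : ℕ, ENNReal.ofReal (z ^ n / n.factorial) * ∫⁻ x : Fin n → Pt d, F (ofTuple x) := by
  rw [lebesguePoisson, lintegral_sum_measure]
  refine tsum_congr fun n => ?_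
  rw [lintegral_smul_measure, lintegral_confMeasure hd n hF, smul_eq_mul]

instance instSFiniteConfMeasure (d n : ℕ) : SFinite (confMeasure d n) := by
  rw [confMeasure_eq_map]
  infer_instance

instance instSFiniteLebesguePoisson (d : ℕ) (z : ℝ) : SFinite (lebesguePoisson d z) := by
  unfold lebesguePoisson
  infer_instance

theorem lintegral_ofTuple_card {d : ℕ} {ι κ : Type*} [Fintype ι] [Fintype κ] (e : ι ≃ κ)
    (F : Conf d → ℝ≥0∞) :
    ∫⁻ x : ι → Pt d, F (ofTuple x) = ∫⁻ x : κ → Pt d, F (ofTuple x) := by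
  have hmp := volume_measurePreserving_piCongrLeft (fun _ : κ => Pt d) e
  rw [← hmp.lintegral_comp_emb (MeasurableEquiv.measurableEmbedding _)]
  refine lintegral_congr fun x => ?_
  congr 1
  ext y
  simp only [ofTuple, Finset.mem_image, Finset.mem_univ, true_and]
  have : ∀ i, (MeasurableEquiv.piCongrLeft (fun _ : κ => Pt d) e) x (e i) = x i := fun i =>
    Equiv.piCongrLeft_apply_apply (P := fun _ : κ => Pt d) e x i
  constructor
  · rintro ⟨i, rfl⟩
    exact ⟨e i, this i⟩
  · rintro ⟨j, rfl⟩
    exact ⟨e.symm j, by rw [← this, e.apply_symm_apply]⟩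

open scoped Classical in
/-- Integration over tuples with the entries split into two groups. -/
theorem lintegral_split {d n : ℕ} (J : Finset (Fin n)) {H : Conf d → Conf d → ℝ≥0∞}
    (hH : Measurable (Function.uncurry H)) :
    ∫⁻ x : Fin n → Pt d, H ⟨J.image x⟩ ⟨(Finset.univ \ J).image x⟩ =
      ∫⁻ x : Fin J.card → Pt d, ∫⁻ y : Fin (n - J.card) → Pt d, H (ofTuple x) (ofTuple y) := by
  have hmp := volume_preserving_piEquivPiSubtypeProd (fun _ : Fin n => Pt d) (fun i => i ∈ J)
  have h1 : ∀ x : Fin n → Pt d, H ⟨J.image x⟩ ⟨(Finset.univ \ J).image x⟩ =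
      (fun q : ({i // i ∈ J} → Pt d) × ({i // i ∉ J} → Pt d) =>
        H (ofTuple q.1) (ofTuple q.2))
        (MeasurableEquiv.piEquivPiSubtypeProd (fun _ : Fin n => Pt d) (fun i => i ∈ J) x) := by
    intro x
    congr 1
    · ext y
      simp [ofTuple, MeasurableEquiv.piEquivPiSubtypeProd, Equiv.piEquivPiSubtypeProd]
    · ext y
      simp [ofTuple, MeasurableEquiv.piEquivPiSubtypeProd, Equiv.piEquivPiSubtypeProd]
  simp only [h1]
  have hm : Measurable fun q : ({i // i ∈ J} → Pt d) × ({i // i ∉ J} → Pt d) =>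
      H (ofTuple q.1) (ofTuple q.2) :=
    hH.comp ((measurable_ofTuple.comp measurable_fst).prodMk
      (measurable_ofTuple.comp measurable_snd))
  rw [hmp.lintegral_comp hm, Measure.volume_eq_prod, lintegral_prod _ hm.aemeasurable]
  have e1 : {i // i ∈ J} ≃ Fin J.card := J.equivFin
  have e2 : {i // i ∉ J} ≃ Fin (n - J.card) := Fintype.equivFinOfCardEq (by simp)
  simp only [lintegral_ofTuple_card e2 (H (ofTuple _))]
  convert lintegral_ofTuple_card e1 fun a =>
    ∫⁻ y : Fin (n - J.card) → Pt d, H a (ofTuple y)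
  all_goals rfl

open scoped Classical in
/-- The integral over `Γ₀` of a sum over the subsets of a configuration. -/
theorem lintegral_sum_powerset {d : ℕ} (hd : 1 ≤ d) {z : ℝ} (hz : 0 ≤ z)
    {H : Conf d → Conf d → ℝ≥0∞} (hH : Measurable (Function.uncurry H)) :
    ∫⁻ η, ∑ p ∈ η.pts.powerset, H ⟨p⟩ ⟨η.pts \ p⟩ ∂(lebesguePoisson d z) =
      ∫⁻ ξ, ∫⁻ ζ, H ξ ζ ∂(lebesguePoisson d z) ∂(lebesguePoisson d z) := by
  set a : ℕ → ℝ≥0∞ := fun n => ENNReal.ofReal (z ^ n / n.factorial) with ha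
  set I : ℕ → ℕ → ℝ≥0∞ := fun k l =>
    ∫⁻ x : Fin k → Pt d, ∫⁻ y : Fin l → Pt d, H (ofTuple x) (ofTuple y) with hI
  have hL : Measurable fun η : Conf d => ∑ p ∈ η.pts.powerset, H ⟨p⟩ ⟨η.pts \ p⟩ :=
    measurable_sum_powerset measurable_id (H := fun _ => H) (hH.comp measurable_snd)
  have hR : Measurable fun ξ => ∫⁻ ζ, H ξ ζ ∂(lebesguePoisson d z) := hH.lintegral_prod_right'
  rw [lintegral_lebesguePoisson hd z hL, lintegral_lebesguePoisson hd z hR]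
  have h1 : ∀ n, ∫⁻ x : Fin n → Pt d, ∑ p ∈ (ofTuple x).pts.powerset,
      H ⟨p⟩ ⟨(ofTuple x).pts \ p⟩ = ∑ q ∈ Finset.HasAntidiagonal.antidiagonal n,
        (n.choose q.1 : ℝ≥0∞) * I q.1 q.2 := by
    intro n
    have hae : ∀ᵐ x : Fin n → Pt d, ∑ p ∈ (ofTuple x).pts.powerset,
        H ⟨p⟩ ⟨(ofTuple x).pts \ p⟩ = ∑ J ∈ (Finset.univ : Finset (Fin n)).powerset,
          H ⟨J.image x⟩ ⟨(Finset.univ \ J).image x⟩ := by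
      filter_upwards [ae_injective hd (Fin n)] with x hx
      exact sum_powerset_image Finset.univ x hx.injOn fun a b => H ⟨a⟩ ⟨b⟩
    rw [lintegral_congr_ae hae, lintegral_finsetSum]
    · simp only [lintegral_split _ hH]
      -- After `lintegral_split` the term of `J` depends only on its cardinality, so the subsets are
      -- counted by binomial coefficients.
      have := Finset.sum_powerset_apply_card (f := fun k => I k (n - k))
        (x := (Finset.univ : Finset (Fin n)))
      rw [this, Finset.Nat.sum_antidiagonal_eq_sum_range_succ_mk]
      simp
    · intro J _
      exact hH.comp ((measurable_image_conf J fun i => measurable_pi_apply i).prodMk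
        (measurable_image_conf _ fun i => measurable_pi_apply i))
  have h2 : ∀ k, ∫⁻ x : Fin k → Pt d, ∫⁻ ζ, H (ofTuple x) ζ ∂(lebesguePoisson d z) =
      ∑' l, a l * I k l := by
    intro k
    have : ∀ x : Fin k → Pt d, ∫⁻ ζ, H (ofTuple x) ζ ∂(lebesguePoisson d z) =
        ∑' l, a l * ∫⁻ y : Fin l → Pt d, H (ofTuple x) (ofTuple y) := fun x =>
      lintegral_lebesguePoisson hd z (hH.comp (measurable_const.prodMk measurable_id))
    simp only [this]
    have hm : ∀ l, Measurable fun x : Fin k → Pt d =>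
        ∫⁻ y : Fin l → Pt d, H (ofTuple x) (ofTuple y) := fun l =>
      Measurable.lintegral_prod_right' (f := fun q : (Fin k → Pt d) × (Fin l → Pt d) =>
        H (ofTuple q.1) (ofTuple q.2)) (hH.comp ((measurable_ofTuple.comp measurable_fst).prodMk
          (measurable_ofTuple.comp measurable_snd)))
    rw [lintegral_tsum fun l => ((hm l).const_mul _).aemeasurable]
    exact tsum_congr fun l => lintegral_const_mul _ (hm l)
  simp only [h1, h2]
  have h3 : ∀ n, a n * ∑ q ∈ Finset.HasAntidiagonal.antidiagonal n,
      (n.choose q.1 : ℝ≥0∞) * I q.1 q.2 =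
      ∑ q ∈ Finset.HasAntidiagonal.antidiagonal n, a q.1 * (a q.2 * I q.1 q.2) := by
    intro n
    rw [Finset.mul_sum]
    refine Finset.sum_congr rfl fun q hq => ?_
    rw [← mul_assoc, ← mul_assoc]
    congr 1
    obtain ⟨k, l⟩ := q
    rw [Finset.HasAntidiagonal.mem_antidiagonal] at hq
    simp only at hq ⊢
    subst hq
    rw [ha]
    simp only
    rw [← ENNReal.ofReal_natCast, ← ENNReal.ofReal_mul (by positivity),
      ← ENNReal.ofReal_mul (by positivity)]
    congr 1
    have := Nat.add_choose_mul_factorial_mul_factorial k l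
    have h' : ((k + l).choose k : ℝ) * k.factorial * l.factorial = (k + l).factorial := by
      rw [Nat.choose_symm_add]
      exact_mod_cast this
    have hk : (k.factorial : ℝ) ≠ 0 := by positivity
    have hl : (l.factorial : ℝ) ≠ 0 := by positivity
    have hkl : ((k + l).factorial : ℝ) ≠ 0 := by positivity
    field_simp
    rw [← h', pow_add]
    ring
  change ∑' n, a n * _ = ∑' k, a k * ∑' l, a l * I k l
  simp only [h3, ← ENNReal.tsum_mul_left]
  -- A Cauchy product: the double series over `(k, l)` is regrouped along the antidiagonals `k + l =
  -- n`.
  rw [← ENNReal.tsum_prod (f := fun k l => a k * (a l * I k l)),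
    ← Finset.HasAntidiagonal.sigmaAntidiagonalEquivProd.tsum_eq, ENNReal.tsum_sigma']
  refine tsum_congr fun n => ?_
  rw [tsum_fintype, ← Finset.sum_coe_sort]
  rfl

open scoped Classical in
/-- The integral over `Γ₀` of a sum over the points of a configuration (Mecke formula). -/
theorem lintegral_sum_points {d : ℕ} (hd : 1 ≤ d) {z : ℝ} (hz : 0 ≤ z)
    {h : Pt d → Conf d → ℝ≥0∞} (hh : Measurable (Function.uncurry h)) :
    ∫⁻ η, ∑ x ∈ η.pts, h x ⟨η.pts \ {x}⟩ ∂(lebesguePoisson d z) =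
      ENNReal.ofReal z * ∫⁻ x, ∫⁻ ζ, h x ζ ∂(lebesguePoisson d z) := by
  -- A function concentrated on singletons `ξ` turns the sum over subsets into a sum over points. On
  -- the other side only `n = 1` survives, with weight `z¹/1! = z`.
  set H : Conf d → Conf d → ℝ≥0∞ := fun ξ ζ =>
    if ξ.pts.card = 1 then ∑ x ∈ ξ.pts, h x ζ else 0 with hHdef
  have hcard : MeasurableSet {q : Conf d × Conf d | q.1.pts.card = 1} :=
    (measurable_card.comp measurable_fst) (measurableSet_singleton 1)
  have hH : Measurable (Function.uncurry H) := by
    refine Measurable.ite hcard ?_ measurable_const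
    exact measurable_sum_points measurable_fst
      (H := fun (q : Conf d × Conf d) x _ => h x q.2) (hh.comp (by fun_prop :
        Measurable fun q : (Conf d × Conf d) × Pt d × Conf d => (q.2.1, q.1.2)))
  have h1 : ∀ η : Conf d, ∑ p ∈ η.pts.powerset, H ⟨p⟩ ⟨η.pts \ p⟩ =
      ∑ x ∈ η.pts, h x ⟨η.pts \ {x}⟩ := by
    intro η
    simp only [hHdef]
    rw [← Finset.sum_filter, ← Finset.powersetCard_eq_filter, Finset.powersetCard_one,
      Finset.sum_map]
    simp
  have h2 := lintegral_sum_powerset hd hz hH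
  simp only [h1] at h2
  rw [h2]
  set k : Pt d → ℝ≥0∞ := fun x => ∫⁻ ζ, h x ζ ∂(lebesguePoisson d z) with hk
  have hkm : Measurable k := hh.lintegral_prod_right'
  have hR : Measurable fun ξ => ∫⁻ ζ, H ξ ζ ∂(lebesguePoisson d z) := hH.lintegral_prod_right'
  rw [lintegral_lebesguePoisson hd z hR, tsum_eq_single 1]
  · rw [← (volume_preserving_funUnique (Fin 1) (Pt d)).lintegral_comp hkm]
    simp only [pow_one, Nat.factorial_one, Nat.cast_one, div_one]
    congr 1
    refine lintegral_congr fun x => ?_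
    simp [hHdef, ofTuple, hk]
  · intro n hn
    have : ∀ᵐ x : Fin n → Pt d, ∫⁻ ζ, H (ofTuple x) ζ ∂(lebesguePoisson d z) = 0 := by
      filter_upwards [ae_injective hd (Fin n)] with x hx
      have hc : (ofTuple x).pts.card = n := by
        rw [ofTuple, Finset.card_image_of_injective _ hx, Finset.card_univ, Fintype.card_fin]
      simp [hHdef, hc, hn]
    rw [lintegral_congr_ae this, lintegral_zero, mul_zero]

open scoped Classical in
/-- A configuration is almost surely disjoint from a given one. -/
theorem ae_disjoint {d : ℕ} (hd : 1 ≤ d) (z : ℝ) (ξ : Conf d) :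
    ∀ᵐ η ∂(lebesguePoisson d z), Disjoint ξ.pts η.pts := by
  have : Nonempty (Fin d) := ⟨⟨0, hd⟩⟩
  have hs : MeasurableSet {η : Conf d | Disjoint ξ.pts η.pts} :=
    measurable_prodMk_left (measurableSet_conf2 d)
  have hsc := hs.compl
  rw [ae_iff]
  change lebesguePoisson d z {η : Conf d | Disjoint ξ.pts η.pts}ᶜ = 0
  rw [← lintegral_indicator_one hsc,
    lintegral_lebesguePoisson hd z (measurable_one.indicator hsc)]
  refine ENNReal.tsum_eq_zero.2 fun n => ?_
  have : ∀ᵐ x : Fin n → Pt d, ({η : Conf d | Disjoint ξ.pts η.pts}ᶜ).indicator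
      (1 : Conf d → ℝ≥0∞) (ofTuple x) = 0 := by
    have h : ∀ i : Fin n, ∀ᵐ x : Fin n → Pt d, x i ∉ ξ.pts := by
      intro i
      refine (Measure.quasiMeasurePreserving_eval (fun _ : Fin n => (volume : Measure (Pt d)))
        i).ae (p := fun y => y ∉ ξ.pts) ?_
      exact ξ.pts.countable_toSet.ae_notMem volume
    filter_upwards [ae_all_iff.2 h] with x hx
    refine Set.indicator_of_notMem ?_ _
    simp only [Set.mem_compl_iff, not_not, Set.mem_ofPred_eq, Finset.disjoint_right, ofTuple,
      Finset.mem_image, Finset.mem_univ, true_and]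
    rintro _ ⟨i, rfl⟩
    exact hx i
  rw [lintegral_congr_ae this, lintegral_zero, mul_zero]

/-- Integration over `Γ₀²`, for functions that are defined on `Γ₀ × Γ₀`. -/
theorem lintegral_lebesguePoisson2 {d : ℕ} (hd : 1 ≤ d) (z : ℝ) {F : Conf d → Conf d → ℝ≥0∞}
    (hF : Measurable (Function.uncurry F)) :
    ∫⁻ η : Conf2 d, F η.1.1 η.1.2 ∂(lebesguePoisson2 d z) =
      ∫⁻ a, ∫⁻ b, F a b ∂(lebesguePoisson d z) ∂(lebesguePoisson d z) := by
  refine (lintegral_subtype_comap (measurableSet_conf2 d)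
    (fun η : Conf d × Conf d => F η.1 η.2)).trans ?_
  rw [Measure.restrict_eq_self_of_ae_mem
    (s := {η : Conf d × Conf d | Disjoint η.1.pts η.2.pts}),
    lintegral_prod (fun η : Conf d × Conf d => F η.1 η.2) hF.aemeasurable]
  exact (Measure.ae_prod_mem_iff_ae_ae_mem (measurableSet_conf2 d)).2
    (Filter.Eventually.of_forall fun ξ => ae_disjoint hd z ξ)

/-- All weights `wⁿ/n!` are positive, so a `λ_w`-null set is null for every `m^{(n)}`. This
transfers almost-everywhere statements between the parameters `1` and `C`. -/
theorem lebesguePoisson_absolutelyContinuous (d : ℕ) {z w : ℝ} (hw : 0 < w) :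
    lebesguePoisson d z ≪ lebesguePoisson d w := by
  unfold lebesguePoisson
  refine Measure.AbsolutelyContinuous.mk fun s hs h => ?_
  rw [Measure.sum_apply _ hs, ENNReal.tsum_eq_zero] at h ⊢
  intro n
  have hn := h n
  rw [Measure.smul_apply, smul_eq_mul, mul_eq_zero] at hn ⊢
  refine Or.inr (hn.resolve_left ?_)
  rw [ENNReal.ofReal_eq_zero, not_le]
  positivity

theorem lebesguePoisson2_absolutelyContinuous (d : ℕ) {z w : ℝ} (hw : 0 < w) :
    lebesguePoisson2 d z ≪ lebesguePoisson2 d w := by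
  have h := (lebesguePoisson_absolutelyContinuous d (z := z) hw).prod
    (lebesguePoisson_absolutelyContinuous d (z := z) hw)
  refine Measure.AbsolutelyContinuous.mk fun s hs h0 => ?_
  rw [lebesguePoisson2, (measurableEmbedding_conf2 d).comap_apply] at h0 ⊢
  exact h h0

open scoped Classical in
/-- The two-component version of `lintegral_sum_powerset`. -/
theorem lintegral_sum_powerset2 {d : ℕ} (hd : 1 ≤ d) {z : ℝ} (hz : 0 ≤ z)
    {H : Conf d → Conf d → Conf d → Conf d → ℝ≥0∞}
    (hH : Measurable fun q : Conf d × Conf d × Conf d × Conf d => H q.1 q.2.1 q.2.2.1 q.2.2.2) :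
    ∫⁻ a, ∫⁻ b, ∑ p ∈ a.pts.powerset, ∑ q ∈ b.pts.powerset,
        H ⟨p⟩ ⟨q⟩ ⟨a.pts \ p⟩ ⟨b.pts \ q⟩ ∂(lebesguePoisson d z) ∂(lebesguePoisson d z) =
      ∫⁻ p, ∫⁻ q, ∫⁻ a, ∫⁻ b, H p q a b ∂(lebesguePoisson d z) ∂(lebesguePoisson d z)
        ∂(lebesguePoisson d z) ∂(lebesguePoisson d z) := by
  have hH1 : ∀ p a, Measurable fun q : Conf d × Conf d => H p q.1 a q.2 := fun p a =>
    hH.comp (by fun_prop : Measurable fun q : Conf d × Conf d => (p, q.1, a, q.2))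
  have h1 : ∀ a : Conf d, ∫⁻ b, ∑ p ∈ a.pts.powerset, ∑ q ∈ b.pts.powerset,
      H ⟨p⟩ ⟨q⟩ ⟨a.pts \ p⟩ ⟨b.pts \ q⟩ ∂(lebesguePoisson d z) =
      ∑ p ∈ a.pts.powerset, ∫⁻ q, ∫⁻ b, H ⟨p⟩ q ⟨a.pts \ p⟩ b ∂(lebesguePoisson d z)
        ∂(lebesguePoisson d z) := by
    intro a
    rw [lintegral_finsetSum]
    · exact Finset.sum_congr rfl fun p _ => lintegral_sum_powerset hd hz
        (H := fun q b => H ⟨p⟩ q ⟨a.pts \ p⟩ b) (hH1 ⟨p⟩ ⟨a.pts \ p⟩)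
    · intro p _
      exact measurable_sum_powerset measurable_id
        (H := fun _ q b => H ⟨p⟩ q ⟨a.pts \ p⟩ b) ((hH1 ⟨p⟩ ⟨a.pts \ p⟩).comp measurable_snd)
  simp only [h1]
  have hm1 : Measurable fun q : Conf d × Conf d × Conf d =>
      ∫⁻ b, H q.1 q.2.1 q.2.2 b ∂(lebesguePoisson d z) :=
    Measurable.lintegral_prod_right' (f := fun q : (Conf d × Conf d × Conf d) × Conf d =>
      H q.1.1 q.1.2.1 q.1.2.2 q.2) (hH.comp (by fun_prop : Measurable
        fun q : (Conf d × Conf d × Conf d) × Conf d => (q.1.1, q.1.2.1, q.1.2.2, q.2)))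
  have hm2 : Measurable fun q : Conf d × Conf d => ∫⁻ r, ∫⁻ b, H q.1 r q.2 b
      ∂(lebesguePoisson d z) ∂(lebesguePoisson d z) :=
    Measurable.lintegral_prod_right' (f := fun q : (Conf d × Conf d) × Conf d =>
      ∫⁻ b, H q.1.1 q.2 q.1.2 b ∂(lebesguePoisson d z)) (hm1.comp (by fun_prop :
        Measurable fun q : (Conf d × Conf d) × Conf d => (q.1.1, q.2, q.1.2)))
  rw [lintegral_sum_powerset hd hz (H := fun p a => ∫⁻ q, ∫⁻ b, H p q a b
    ∂(lebesguePoisson d z) ∂(lebesguePoisson d z)) hm2]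
  refine lintegral_congr fun p => ?_
  -- The two one-component applications leave the order `p, a, q, b`; Tonelli exchanges `a` and `q`.
  refine lintegral_lintegral_swap ?_
  exact (hm1.comp (by fun_prop :
        Measurable fun q : Conf d × Conf d => (p, q.2, q.1))).aemeasurable

/-! ### Birth and death terms with general kernels, and their integrals -/

/-- The integral of a kernel in its last two arguments. -/
def kerInt {d : ℕ} (z : ℝ) (k : Pt d → Conf d → Conf d → Conf d → Conf d → ℝ≥0∞) (x : Pt d)
    (p q : Conf d) : ℝ≥0∞ :=
  ∫⁻ a, ∫⁻ b, k x p q a b ∂(lebesguePoisson d z) ∂(lebesguePoisson d z)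

/-- Joint measurability of a kernel. -/
def MeasurableKer {d : ℕ} {M : Type*} [MeasurableSpace M]
    (k : Pt d → Conf d → Conf d → Conf d → Conf d → M) : Prop :=
  Measurable fun w : Pt d × Conf d × Conf d × Conf d × Conf d =>
    k w.1 w.2.1 w.2.2.1 w.2.2.2.1 w.2.2.2.2

section

variable {d : ℕ} {M : Type*} [MeasurableSpace M] {k : Pt d → Conf d → Conf d → Conf d → Conf d → M}
  {g : Conf d → Conf d → M}

theorem MeasurableKer.comp {X : Type*} [MeasurableSpace X] (hk : MeasurableKer k) {x : X → Pt d}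
    {p q a b : X → Conf d} (hx : Measurable x) (hp : Measurable p) (hq : Measurable q)
    (ha : Measurable a) (hb : Measurable b) :
    Measurable fun t => k (x t) (p t) (q t) (a t) (b t) :=
  Measurable.comp hk (hx.prodMk (hp.prodMk (hq.prodMk (ha.prodMk hb))))

open scoped Classical in
theorem measurable_insert_conf {X : Type*} [MeasurableSpace X] {p : X → Conf d} {x : X → Pt d}
    (hp : Measurable p) (hx : Measurable x) :
    Measurable fun t => (⟨(p t).pts ∪ {x t}⟩ : Conf d) :=
  measurable_union_conf hp (measurable_singleton_conf.comp hx)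

open scoped Classical in
/-- The two-component version of `measurable_sum_powerset`. -/
theorem measurable_sum_powerset2 [AddCommMonoid M] [MeasurableAdd₂ M]
    {H : Conf d → Conf d → Conf d → Conf d → M}
    (hH : Measurable fun q : Conf d × Conf d × Conf d × Conf d => H q.1 q.2.1 q.2.2.1 q.2.2.2) :
    Measurable (Function.uncurry fun a b : Conf d => ∑ p ∈ a.pts.powerset,
      ∑ q ∈ b.pts.powerset, H ⟨p⟩ ⟨q⟩ ⟨a.pts \ p⟩ ⟨b.pts \ q⟩) := by
  refine measurable_sum_powerset (f := fun w : Conf d × Conf d => w.1) measurable_fst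
    (H := fun w p p' => ∑ q ∈ w.2.pts.powerset, H p ⟨q⟩ p' ⟨w.2.pts \ q⟩) ?_
  refine measurable_sum_powerset
    (f := fun w : (Conf d × Conf d) × Conf d × Conf d => w.1.2) (by fun_prop)
    (H := fun w q q' => H w.2.1 q w.2.2 q') ?_
  exact hH.comp (by fun_prop : Measurable fun w : ((Conf d × Conf d) × Conf d × Conf d) ×
    Conf d × Conf d => (w.1.2.1, w.2.1, w.1.2.2, w.2.2))

variable [NonUnitalNonAssocSemiring M] [MeasurableMul₂ M]

open scoped Classical in
theorem measurable_deathPlus_summand [MeasurableAdd₂ M] (hg : Measurable (Function.uncurry g))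
    (hk : MeasurableKer k) :
    Measurable fun w : Conf d × Conf d × Conf d × Conf d =>
      g w.1 w.2.1 * ∑ x ∈ w.1.pts, k x ⟨w.1.pts \ {x}⟩ w.2.1 w.2.2.1 w.2.2.2 := by
  refine Measurable.mul (hg.comp (by fun_prop :
    Measurable fun w : Conf d × Conf d × Conf d × Conf d => (w.1, w.2.1))) ?_
  refine measurable_sum_points measurable_fst
    (H := fun (w : Conf d × Conf d × Conf d × Conf d) x c => k x c w.2.1 w.2.2.1 w.2.2.2) ?_
  exact hk.comp (by fun_prop) (by fun_prop) (by fun_prop) (by fun_prop) (by fun_prop)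

open scoped Classical in
theorem measurable_deathMinus_summand [MeasurableAdd₂ M] (hg : Measurable (Function.uncurry g))
    (hk : MeasurableKer k) :
    Measurable fun w : Conf d × Conf d × Conf d × Conf d =>
      g w.1 w.2.1 * ∑ y ∈ w.2.1.pts, k y w.1 ⟨w.2.1.pts \ {y}⟩ w.2.2.1 w.2.2.2 := by
  refine Measurable.mul (hg.comp (by fun_prop :
    Measurable fun w : Conf d × Conf d × Conf d × Conf d => (w.1, w.2.1))) ?_
  refine measurable_sum_points (measurable_fst.comp measurable_snd)
    (H := fun (w : Conf d × Conf d × Conf d × Conf d) y c => k y w.1 c w.2.2.1 w.2.2.2) ?_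
  exact hk.comp (by fun_prop) (by fun_prop) (by fun_prop) (by fun_prop) (by fun_prop)

open scoped Classical in
theorem measurable_birthPlus_summand (hg : Measurable (Function.uncurry g)) (hk : MeasurableKer k) :
    Measurable fun w : (Conf d × Conf d × Conf d × Conf d) × Pt d =>
      g ⟨w.1.1.pts ∪ {w.2}⟩ w.1.2.1 * k w.2 w.1.1 w.1.2.1 w.1.2.2.1 w.1.2.2.2 :=
  (hg.comp ((measurable_insert_conf (p := fun w : (Conf d × Conf d × Conf d × Conf d) × Pt d =>
    w.1.1) (x := fun w => w.2) (by fun_prop) (by fun_prop)).prodMk (by fun_prop :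
      Measurable fun w : (Conf d × Conf d × Conf d × Conf d) × Pt d => w.1.2.1))).mul
    (hk.comp (by fun_prop) (by fun_prop) (by fun_prop) (by fun_prop) (by fun_prop))

open scoped Classical in
theorem measurable_birthMinus_summand (hg : Measurable (Function.uncurry g)) (hk : MeasurableKer k) :
    Measurable fun w : (Conf d × Conf d × Conf d × Conf d) × Pt d =>
      g w.1.1 ⟨w.1.2.1.pts ∪ {w.2}⟩ * k w.2 w.1.1 w.1.2.1 w.1.2.2.1 w.1.2.2.2 :=
  (hg.comp ((by fun_prop :
      Measurable fun w : (Conf d × Conf d × Conf d × Conf d) × Pt d => w.1.1).prodMk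
    (measurable_insert_conf (p := fun w : (Conf d × Conf d × Conf d × Conf d) × Pt d => w.1.2.1)
      (x := fun w => w.2) (by fun_prop) (by fun_prop)))).mul
    (hk.comp (by fun_prop) (by fun_prop) (by fun_prop) (by fun_prop) (by fun_prop))

open scoped Classical in
/-- The death term of `+`-particles for a general function and a general kernel. -/
def deathPlus (g : Conf d → Conf d → M) (k : Pt d → Conf d → Conf d → Conf d → Conf d → M)
    (a b : Conf d) : M :=
  ∑ p ∈ a.pts.powerset, ∑ q ∈ b.pts.powerset,
    g ⟨p⟩ ⟨q⟩ * ∑ x ∈ p, k x ⟨p \ {x}⟩ ⟨q⟩ ⟨a.pts \ p⟩ ⟨b.pts \ q⟩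

open scoped Classical in
/-- The death term of `-`-particles for a general function and a general kernel. -/
def deathMinus (g : Conf d → Conf d → M) (k : Pt d → Conf d → Conf d → Conf d → Conf d → M)
    (a b : Conf d) : M :=
  ∑ p ∈ a.pts.powerset, ∑ q ∈ b.pts.powerset,
    g ⟨p⟩ ⟨q⟩ * ∑ y ∈ q, k y ⟨p⟩ ⟨q \ {y}⟩ ⟨a.pts \ p⟩ ⟨b.pts \ q⟩

open scoped Classical in
theorem measurable_deathPlus [MeasurableAdd₂ M] (hg : Measurable (Function.uncurry g))
    (hk : MeasurableKer k) : Measurable (Function.uncurry (deathPlus g k)) :=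
  measurable_sum_powerset2
    (H := fun p q a b => g p q * ∑ x ∈ p.pts, k x ⟨p.pts \ {x}⟩ q a b)
    (measurable_deathPlus_summand hg hk)

open scoped Classical in
theorem measurable_deathMinus [MeasurableAdd₂ M] (hg : Measurable (Function.uncurry g))
    (hk : MeasurableKer k) : Measurable (Function.uncurry (deathMinus g k)) :=
  measurable_sum_powerset2
    (H := fun p q a b => g p q * ∑ y ∈ q.pts, k y p ⟨q.pts \ {y}⟩ a b)
    (measurable_deathMinus_summand hg hk)

end

section

variable {d : ℕ} {k : Pt d → Conf d → Conf d → Conf d → Conf d → ℝ≥0∞} {g : Conf d → Conf d → ℝ≥0∞}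

open scoped Classical in
/-- The birth term of `+`-particles for a nonnegative function and a nonnegative kernel. -/
def birthPlus (g : Conf d → Conf d → ℝ≥0∞)
    (k : Pt d → Conf d → Conf d → Conf d → Conf d → ℝ≥0∞) (a b : Conf d) : ℝ≥0∞ :=
  ∑ p ∈ a.pts.powerset, ∑ q ∈ b.pts.powerset,
    ∫⁻ x, g ⟨p ∪ {x}⟩ ⟨q⟩ * k x ⟨p⟩ ⟨q⟩ ⟨a.pts \ p⟩ ⟨b.pts \ q⟩

open scoped Classical in
/-- The birth term of `-`-particles for a nonnegative function and a nonnegative kernel. -/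
def birthMinus (g : Conf d → Conf d → ℝ≥0∞)
    (k : Pt d → Conf d → Conf d → Conf d → Conf d → ℝ≥0∞) (a b : Conf d) : ℝ≥0∞ :=
  ∑ p ∈ a.pts.powerset, ∑ q ∈ b.pts.powerset,
    ∫⁻ y, g ⟨p⟩ ⟨q ∪ {y}⟩ * k y ⟨p⟩ ⟨q⟩ ⟨a.pts \ p⟩ ⟨b.pts \ q⟩

open scoped Classical in
theorem measurable_birthPlus (hg : Measurable (Function.uncurry g)) (hk : MeasurableKer k) :
    Measurable (Function.uncurry (birthPlus g k)) :=
  measurable_sum_powerset2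
    (H := fun p q a b => ∫⁻ x, g ⟨p.pts ∪ {x}⟩ q * k x p q a b)
    ((measurable_birthPlus_summand hg hk).lintegral_prod_right' (ν := (volume : Measure (Pt d))))

open scoped Classical in
theorem measurable_birthMinus (hg : Measurable (Function.uncurry g)) (hk : MeasurableKer k) :
    Measurable (Function.uncurry (birthMinus g k)) :=
  measurable_sum_powerset2
    (H := fun p q a b => ∫⁻ y, g p ⟨q.pts ∪ {y}⟩ * k y p q a b)
    ((measurable_birthMinus_summand hg hk).lintegral_prod_right' (ν := (volume : Measure (Pt d))))

theorem MeasurableKer.kerInt (hk : MeasurableKer k) (z : ℝ) {X : Type*} [MeasurableSpace X]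
    {x : X → Pt d} {p q : X → Conf d} (hx : Measurable x) (hp : Measurable p)
    (hq : Measurable q) : Measurable fun t => kerInt z k (x t) (p t) (q t) := by
  refine Measurable.lintegral_prod_right' (f := fun s : X × Conf d =>
    ∫⁻ b, k (x s.1) (p s.1) (q s.1) s.2 b ∂(lebesguePoisson d z)) ?_
  refine Measurable.lintegral_prod_right' (f := fun s : (X × Conf d) × Conf d =>
    k (x s.1.1) (p s.1.1) (q s.1.1) s.1.2 s.2) ?_
  exact hk.comp (by fun_prop) (by fun_prop) (by fun_prop) (by fun_prop) (by fun_prop)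

theorem MeasurableKer.lintegral_lintegral_sum (hk : MeasurableKer k) (z : ℝ) (c : ℝ≥0∞)
    (s : Finset (Pt d)) (p q : Pt d → Conf d) :
    ∫⁻ a, ∫⁻ b, c * ∑ x ∈ s, k x (p x) (q x) a b ∂(lebesguePoisson d z)
      ∂(lebesguePoisson d z) = c * ∑ x ∈ s, BirthDeath.kerInt z k x (p x) (q x) := by
  have h1 : ∀ x, Measurable fun w : Conf d × Conf d => k x (p x) (q x) w.1 w.2 := fun x =>
    hk.comp measurable_const measurable_const measurable_const measurable_fst measurable_snd
  have h2 : ∀ x a, Measurable fun b => k x (p x) (q x) a b := fun x a =>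
    (h1 x).comp measurable_prodMk_left
  have h3 : ∀ x, Measurable fun a => ∫⁻ b, k x (p x) (q x) a b ∂(lebesguePoisson d z) :=
    fun x => (h1 x).lintegral_prod_right'
  have h4 : ∀ a, ∫⁻ b, c * ∑ x ∈ s, k x (p x) (q x) a b ∂(lebesguePoisson d z) =
      c * ∑ x ∈ s, ∫⁻ b, k x (p x) (q x) a b ∂(lebesguePoisson d z) := fun a => by
    rw [lintegral_const_mul _ (Finset.measurable_sum _ fun x _ => h2 x a),
      lintegral_finsetSum _ fun x _ => h2 x a]
  simp only [h4]
  rw [lintegral_const_mul _ (Finset.measurable_sum _ fun x _ => h3 x),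
      lintegral_finsetSum _ fun x _ => h3 x]
  rfl

open scoped Classical in
theorem lintegral_deathPlus (hd : 1 ≤ d) {z : ℝ} (hz : 0 ≤ z)
    (hg : Measurable (Function.uncurry g)) (hk : MeasurableKer k) :
    ∫⁻ a, ∫⁻ b, deathPlus g k a b ∂(lebesguePoisson d z)
      ∂(lebesguePoisson d z) =
      ∫⁻ p, ∫⁻ q, g p q * ∑ x ∈ p.pts, kerInt z k x ⟨p.pts \ {x}⟩ q
        ∂(lebesguePoisson d z) ∂(lebesguePoisson d z) := by
  have hm := measurable_deathPlus_summand hg hk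
  refine (lintegral_sum_powerset2 hd hz (H := fun p q a b =>
    g p q * ∑ x ∈ p.pts, k x ⟨p.pts \ {x}⟩ q a b) hm).trans ?_
  exact lintegral_congr fun p => lintegral_congr fun q =>
    hk.lintegral_lintegral_sum z (g p q) p.pts (fun x => ⟨p.pts \ {x}⟩) fun _ => q

open scoped Classical in
theorem lintegral_deathMinus (hd : 1 ≤ d) {z : ℝ} (hz : 0 ≤ z)
    (hg : Measurable (Function.uncurry g)) (hk : MeasurableKer k) :
    ∫⁻ a, ∫⁻ b, deathMinus g k a b ∂(lebesguePoisson d z)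
      ∂(lebesguePoisson d z) =
      ∫⁻ p, ∫⁻ q, g p q * ∑ y ∈ q.pts, kerInt z k y p ⟨q.pts \ {y}⟩
        ∂(lebesguePoisson d z) ∂(lebesguePoisson d z) := by
  have hm := measurable_deathMinus_summand hg hk
  refine (lintegral_sum_powerset2 hd hz (H := fun p q a b =>
    g p q * ∑ y ∈ q.pts, k y p ⟨q.pts \ {y}⟩ a b) hm).trans ?_
  exact lintegral_congr fun p => lintegral_congr fun q =>
    hk.lintegral_lintegral_sum z (g p q) q.pts (fun _ => p) fun y => ⟨q.pts \ {y}⟩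

/-- Integrals in the last two arguments of a product integrated over `ℝ^d`. -/
theorem MeasurableKer.lintegral_lintegral_lintegral (hk : MeasurableKer k) (z : ℝ)
    {c : Pt d → ℝ≥0∞} (hc : Measurable c) (p q : Conf d) :
    ∫⁻ a, ∫⁻ b, ∫⁻ x, c x * k x p q a b ∂volume ∂(lebesguePoisson d z)
      ∂(lebesguePoisson d z) = ∫⁻ x, c x * BirthDeath.kerInt z k x p q := by
  have h1 : Measurable fun w : Conf d × Conf d × Pt d => c w.2.2 * k w.2.2 p q w.1 w.2.1 :=
    (hc.comp (by fun_prop)).mul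
      (hk.comp (by fun_prop) (by fun_prop) (by fun_prop) (by fun_prop) (by fun_prop))
  have h2 : ∀ a, ∫⁻ b, ∫⁻ x, c x * k x p q a b ∂volume ∂(lebesguePoisson d z) =
      ∫⁻ x, ∫⁻ b, c x * k x p q a b ∂(lebesguePoisson d z) := fun a =>
    lintegral_lintegral_swap (h1.comp measurable_prodMk_left).aemeasurable
  simp only [h2]
  have h3 : Measurable fun w : Conf d × Pt d =>
      ∫⁻ b, c w.2 * k w.2 p q w.1 b ∂(lebesguePoisson d z) :=
    Measurable.lintegral_prod_right' (f := fun w : (Conf d × Pt d) × Conf d =>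
      c w.1.2 * k w.1.2 p q w.1.1 w.2) (h1.comp (by fun_prop :
        Measurable fun w : (Conf d × Pt d) × Conf d => (w.1.1, w.2, w.1.2)))
  rw [lintegral_lintegral_swap h3.aemeasurable]
  refine lintegral_congr fun x => ?_
  have h4 : Measurable fun w : Conf d × Conf d => k x p q w.1 w.2 :=
    hk.comp (by fun_prop) (by fun_prop) (by fun_prop) (by fun_prop) (by fun_prop)
  have h5 : ∀ a, ∫⁻ b, c x * k x p q a b ∂(lebesguePoisson d z) =
      c x * ∫⁻ b, k x p q a b ∂(lebesguePoisson d z) := fun a =>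
    lintegral_const_mul _ (h4.comp measurable_prodMk_left)
  simp only [h5]
  exact lintegral_const_mul _ h4.lintegral_prod_right'

-- Integrating out `a` and `b` leaves an integral over the added point `x`. Mecke's formula read
-- from right to left makes `x` a point of `p`, and this is the source of `1 / z`.
open scoped Classical in
theorem lintegral_birthPlus (hd : 1 ≤ d) {z : ℝ} (hz : 0 < z)
    (hg : Measurable (Function.uncurry g)) (hk : MeasurableKer k) :
    ∫⁻ a, ∫⁻ b, birthPlus g k a b ∂(lebesguePoisson d z)
      ∂(lebesguePoisson d z) =
      ∫⁻ p, ∫⁻ q, g p q * (ENNReal.ofReal (1 / z) *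
          ∑ x ∈ p.pts, kerInt z k x ⟨p.pts \ {x}⟩ q)
        ∂(lebesguePoisson d z) ∂(lebesguePoisson d z) := by
  have hins : ∀ {X : Type} [MeasurableSpace X] {p q : X → Conf d} {x : X → Pt d},
      Measurable p → Measurable q → Measurable x →
      Measurable fun t => g ⟨(p t).pts ∪ {x t}⟩ (q t) := fun hp hq hx =>
    hg.comp ((measurable_insert_conf hp hx).prodMk hq)
  have hm := (measurable_birthPlus_summand hg hk).lintegral_prod_right'
    (ν := (volume : Measure (Pt d)))
  refine (lintegral_sum_powerset2 hd hz.le (H := fun p q a b =>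
    ∫⁻ x, g ⟨p.pts ∪ {x}⟩ q * k x p q a b) hm).trans ?_
  have h1 : ∀ p q : Conf d, ∫⁻ a, ∫⁻ b, ∫⁻ x, g ⟨p.pts ∪ {x}⟩ q * k x p q a b ∂volume
      ∂(lebesguePoisson d z) ∂(lebesguePoisson d z) =
      ∫⁻ x, g ⟨p.pts ∪ {x}⟩ q * kerInt z k x p q := fun p q =>
    hk.lintegral_lintegral_lintegral z
      (hins (p := fun _ : Pt d => p) measurable_const measurable_const measurable_id) p q
  simp only [h1]
  have hm2 : Measurable fun w : Pt d × Conf d × Conf d =>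
      g ⟨w.2.1.pts ∪ {w.1}⟩ w.2.2 * kerInt z k w.1 w.2.1 w.2.2 :=
    (hins (p := fun w : Pt d × Conf d × Conf d => w.2.1)
        (by fun_prop) (by fun_prop) (by fun_prop)).mul
      (hk.kerInt z (by fun_prop) (by fun_prop) (by fun_prop))
  -- Mecke's formula acts on `x` and `p`, so the integral over `q` is first moved inside and hidden
  -- in `h`.
  have h2 : ∀ p : Conf d, ∫⁻ q, ∫⁻ x, g ⟨p.pts ∪ {x}⟩ q * kerInt z k x p q ∂volume
      ∂(lebesguePoisson d z) = ∫⁻ x, ∫⁻ q, g ⟨p.pts ∪ {x}⟩ q * kerInt z k x p q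
      ∂(lebesguePoisson d z) := fun p =>
    lintegral_lintegral_swap (hm2.comp (by fun_prop :
      Measurable fun w : Conf d × Pt d => (w.2, p, w.1))).aemeasurable
  simp only [h2]
  set h : Pt d → Conf d → ℝ≥0∞ := fun x p =>
    ∫⁻ q, g ⟨p.pts ∪ {x}⟩ q * kerInt z k x p q ∂(lebesguePoisson d z) with hh
  have hhm : Measurable (Function.uncurry h) :=
    Measurable.lintegral_prod_right' (f := fun w : (Pt d × Conf d) × Conf d =>
      g ⟨w.1.2.pts ∪ {w.1.1}⟩ w.2 * kerInt z k w.1.1 w.1.2 w.2) (hm2.comp (by fun_prop :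
        Measurable fun w : (Pt d × Conf d) × Conf d => (w.1.1, w.1.2, w.2)))
  have hMecke := lintegral_sum_points hd hz.le hhm
  have hswap : ∫⁻ p, ∫⁻ x, h x p ∂volume ∂(lebesguePoisson d z) =
      ∫⁻ x, ∫⁻ p, h x p ∂(lebesguePoisson d z) :=
    lintegral_lintegral_swap (hhm.comp measurable_swap).aemeasurable
  refine hswap.trans ?_
  have hz1 : ENNReal.ofReal (1 / z) * ENNReal.ofReal z = 1 := by
    rw [← ENNReal.ofReal_mul (by positivity), one_div_mul_cancel hz.ne', ENNReal.ofReal_one]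
  -- Writing `1 = (1 / z) * z` supplies the factor `z` that the Mecke formula carries.
  rw [← one_mul (∫⁻ x, ∫⁻ p, h x p ∂(lebesguePoisson d z)), ← hz1, mul_assoc, ← hMecke]
  have hsm : Measurable fun η : Conf d => ∑ x ∈ η.pts, h x ⟨η.pts \ {x}⟩ :=
    measurable_sum_points measurable_id (H := fun _ => h) (hhm.comp measurable_snd)
  rw [← lintegral_const_mul _ hsm]
  refine lintegral_congr fun p => ?_
  have hgm : Measurable fun q => g p q := hg.comp measurable_prodMk_left
  have hKm : ∀ x, Measurable fun q => kerInt z k x ⟨p.pts \ {x}⟩ q := fun x =>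
    hk.kerInt z measurable_const measurable_const measurable_id
  have hgK : ∀ x, Measurable fun q => g p q * kerInt z k x ⟨p.pts \ {x}⟩ q := fun x =>
    hgm.mul (hKm x)
  have h3 : ∀ x ∈ p.pts, h x ⟨p.pts \ {x}⟩ =
      ∫⁻ q, g p q * kerInt z k x ⟨p.pts \ {x}⟩ q ∂(lebesguePoisson d z) := by
    intro x hx
    simp only [hh]
    rw [Finset.sdiff_union_of_subset (Finset.singleton_subset_iff.2 hx)]
  rw [Finset.sum_congr rfl h3, ← lintegral_finsetSum _ fun x _ => hgK x,
    ← lintegral_const_mul _ (Finset.measurable_sum _ fun x _ => hgK x)]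
  refine lintegral_congr fun q => ?_
  rw [← Finset.mul_sum, mul_left_comm]

open scoped Classical in
theorem lintegral_birthMinus (hd : 1 ≤ d) {z : ℝ} (hz : 0 < z)
    (hg : Measurable (Function.uncurry g)) (hk : MeasurableKer k) :
    ∫⁻ a, ∫⁻ b, birthMinus g k a b ∂(lebesguePoisson d z)
      ∂(lebesguePoisson d z) =
      ∫⁻ p, ∫⁻ q, g p q * (ENNReal.ofReal (1 / z) *
          ∑ y ∈ q.pts, kerInt z k y p ⟨q.pts \ {y}⟩)
        ∂(lebesguePoisson d z) ∂(lebesguePoisson d z) := by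
  have hins : ∀ {X : Type} [MeasurableSpace X] {p q : X → Conf d} {x : X → Pt d},
      Measurable p → Measurable q → Measurable x →
      Measurable fun t => g (p t) ⟨(q t).pts ∪ {x t}⟩ := fun hp hq hx =>
    hg.comp (hp.prodMk (measurable_insert_conf hq hx))
  have hm := (measurable_birthMinus_summand hg hk).lintegral_prod_right'
    (ν := (volume : Measure (Pt d)))
  refine (lintegral_sum_powerset2 hd hz.le (H := fun p q a b =>
    ∫⁻ y, g p ⟨q.pts ∪ {y}⟩ * k y p q a b) hm).trans ?_
  refine lintegral_congr fun p => ?_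
  have h1 : ∀ q : Conf d, ∫⁻ a, ∫⁻ b, ∫⁻ y, g p ⟨q.pts ∪ {y}⟩ * k y p q a b ∂volume
      ∂(lebesguePoisson d z) ∂(lebesguePoisson d z) =
      ∫⁻ y, g p ⟨q.pts ∪ {y}⟩ * kerInt z k y p q := fun q =>
    hk.lintegral_lintegral_lintegral z
      (hins (q := fun _ : Pt d => q) measurable_const measurable_const measurable_id) p q
  simp only [h1]
  set h : Pt d → Conf d → ℝ≥0∞ := fun y q => g p ⟨q.pts ∪ {y}⟩ * kerInt z k y p q with hh
  have hhm : Measurable (Function.uncurry h) :=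
    (hins (q := fun w : Pt d × Conf d => w.2) (by fun_prop) (by fun_prop) (by fun_prop)).mul
      (hk.kerInt z (by fun_prop) (by fun_prop) (by fun_prop))
  have hMecke := lintegral_sum_points hd hz.le hhm
  have hswap : ∫⁻ q, ∫⁻ y, h y q ∂volume ∂(lebesguePoisson d z) =
      ∫⁻ y, ∫⁻ q, h y q ∂(lebesguePoisson d z) :=
    lintegral_lintegral_swap (hhm.comp measurable_swap).aemeasurable
  refine hswap.trans ?_
  have hz1 : ENNReal.ofReal (1 / z) * ENNReal.ofReal z = 1 := by
    rw [← ENNReal.ofReal_mul (by positivity), one_div_mul_cancel hz.ne', ENNReal.ofReal_one]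
  rw [← one_mul (∫⁻ y, ∫⁻ q, h y q ∂(lebesguePoisson d z)), ← hz1, mul_assoc, ← hMecke]
  have hsm : Measurable fun η : Conf d => ∑ y ∈ η.pts, h y ⟨η.pts \ {y}⟩ :=
    measurable_sum_points measurable_id (H := fun _ => h) (hhm.comp measurable_snd)
  rw [← lintegral_const_mul _ hsm]
  refine lintegral_congr fun q => ?_
  have h3 : ∀ y ∈ q.pts, h y ⟨q.pts \ {y}⟩ = g p q * kerInt z k y p ⟨q.pts \ {y}⟩ := by
    intro y hy
    simp only [hh]
    rw [Finset.sdiff_union_of_subset (Finset.singleton_subset_iff.2 hy)]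
  rw [Finset.sum_congr rfl h3, ← Finset.mul_sum, mul_left_comm]

end

/-! ### The majorant of `L̂G` and its integral -/

/-- The function `(x, ξ, η) ↦ R(x, ξ, η)` of configurations that belongs to a rate. -/
def rateKer {d : ℕ} (r : Pt d → Conf2 d → ℝ) (x : Pt d) (p q a b : Conf d) : ℝ :=
  rateK r x p.pts q.pts a.pts b.pts

/-- A function on `Γ₀²`, extended by zero to `Γ₀ × Γ₀`. -/
def extend {d : ℕ} (G : Conf2 d → ℝ) (p q : Conf d) : ℝ := val G p.pts q.pts

variable {d : ℕ}

theorem measurableKer_rateKer {r : Pt d → Conf2 d → ℝ} (hr : IsRate r) :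
    MeasurableKer (rateKer r) :=
  measurable_rateK hr.measurable (by fun_prop) (by fun_prop) (by fun_prop) (by fun_prop)
    (by fun_prop)

theorem measurable_extend {G : Conf2 d → ℝ} (hG : Measurable G) :
    Measurable (Function.uncurry (extend G)) :=
  measurable_val hG measurable_fst measurable_snd

theorem extend_apply (G : Conf2 d → ℝ) (η : Conf2 d) : extend G η.1.1 η.1.2 = G η := by
  rw [extend, val, dif_pos η.2]

/-- The absolute value of a kernel. -/
def absKer (k : Pt d → Conf d → Conf d → Conf d → Conf d → ℝ) (x : Pt d) (p q a b : Conf d) :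
    ℝ≥0∞ := ‖k x p q a b‖ₑ

/-- The absolute value of a function on `Γ₀²`, extended by zero. -/
def absExtend (G : Conf2 d → ℝ) (p q : Conf d) : ℝ≥0∞ := ‖extend G p q‖ₑ

/-- The two death terms and the two birth terms of `L̂G` with absolute values inserted. -/
def majorant (R : Rates d) (G : Conf2 d → ℝ) (a b : Conf d) : ℝ≥0∞ :=
  deathPlus (absExtend G) (absKer (rateKer R.dp)) a b
  + birthPlus (absExtend G) (absKer (rateKer R.bp)) a b
  + deathMinus (absExtend G) (absKer (rateKer R.dm)) a b
  + birthMinus (absExtend G) (absKer (rateKer R.bm)) a b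

theorem MeasurableKer.absKer {k : Pt d → Conf d → Conf d → Conf d → Conf d → ℝ}
    (hk : MeasurableKer k) : MeasurableKer (absKer k) :=
  Measurable.enorm hk

theorem measurable_absExtend {G : Conf2 d → ℝ} (hG : Measurable G) :
    Measurable (Function.uncurry (absExtend G)) :=
  (measurable_extend hG).enorm

theorem absExtend_apply (G : Conf2 d → ℝ) (η : Conf2 d) : absExtend G η.1.1 η.1.2 = ‖G η‖ₑ := by
  rw [absExtend, extend_apply]

/-- The norm integrates over disjoint pairs only and `kerInt` over all pairs; the difference is a
null set. -/
theorem normLC_rateK (hd : 1 ≤ d) (C : ℝ) {r : Pt d → Conf2 d → ℝ} (hr : IsRate r) (x : Pt d)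
    (p q : Conf d) :
    normLC C (fun ζ : Conf2 d => rateK r x p.pts q.pts ζ.1.1.pts ζ.1.2.pts) =
      kerInt C (absKer (rateKer r)) x p q := by
  rw [normLC, eLpNorm_one_eq_lintegral_enorm]
  exact lintegral_lebesguePoisson2 hd C (F := fun a b => absKer (rateKer r) x p q a b)
    ((measurableKer_rateKer hr).absKer.comp (by fun_prop) (by fun_prop) (by fun_prop)
      (by fun_prop) (by fun_prop))

open scoped Classical in
/-- The sum over the `+`-particles of the integrals of a kernel. -/
def kerSumPlus (z : ℝ) (k : Pt d → Conf d → Conf d → Conf d → Conf d → ℝ≥0∞) (p q : Conf d) :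
    ℝ≥0∞ := ∑ x ∈ p.pts, kerInt z k x ⟨p.pts \ {x}⟩ q

open scoped Classical in
/-- The sum over the `-`-particles of the integrals of a kernel. -/
def kerSumMinus (z : ℝ) (k : Pt d → Conf d → Conf d → Conf d → Conf d → ℝ≥0∞) (p q : Conf d) :
    ℝ≥0∞ := ∑ y ∈ q.pts, kerInt z k y p ⟨q.pts \ {y}⟩

open scoped Classical in
theorem measurable_kerSumPlus {k : Pt d → Conf d → Conf d → Conf d → Conf d → ℝ≥0∞}
    (hk : MeasurableKer k) (z : ℝ) : Measurable (Function.uncurry (kerSumPlus z k)) :=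
  measurable_sum_points measurable_fst (H := fun (w : Conf d × Conf d) x c => kerInt z k x c w.2)
    (hk.kerInt z (by fun_prop) (by fun_prop) (by fun_prop))

open scoped Classical in
theorem measurable_kerSumMinus {k : Pt d → Conf d → Conf d → Conf d → Conf d → ℝ≥0∞}
    (hk : MeasurableKer k) (z : ℝ) : Measurable (Function.uncurry (kerSumMinus z k)) :=
  measurable_sum_points measurable_snd (H := fun (w : Conf d × Conf d) y c => kerInt z k y w.1 c)
    (hk.kerInt z (by fun_prop) (by fun_prop) (by fun_prop))

theorem measurable_comp_val {F : Conf d → Conf d → ℝ≥0∞} (hF : Measurable (Function.uncurry F)) :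
    Measurable fun η : Conf2 d => F η.1.1 η.1.2 :=
  hF.comp measurable_subtype_coe

theorem rateNormSum_eq (hd : 1 ≤ d) (R : Rates d) (C : ℝ) (η : Conf2 d) :
    rateNormSum R C η = kerSumPlus C (absKer (rateKer R.dp)) η.1.1 η.1.2
      + ENNReal.ofReal (1 / C) * kerSumPlus C (absKer (rateKer R.bp)) η.1.1 η.1.2
      + kerSumMinus C (absKer (rateKer R.dm)) η.1.1 η.1.2
      + ENNReal.ofReal (1 / C) * kerSumMinus C (absKer (rateKer R.bm)) η.1.1 η.1.2 := by
  unfold rateNormSum kerSumPlus kerSumMinus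
  congr 1
  · congr 1
    · congr 1
      · exact Finset.sum_congr rfl fun x _ => normLC_rateK hd C R.dp_isRate x ⟨_⟩ η.1.2
      · congr 1
        exact Finset.sum_congr rfl fun x _ => normLC_rateK hd C R.bp_isRate x ⟨_⟩ η.1.2
    · exact Finset.sum_congr rfl fun y _ => normLC_rateK hd C R.dm_isRate y η.1.1 ⟨_⟩
  · congr 1
    exact Finset.sum_congr rfl fun y _ => normLC_rateK hd C R.bm_isRate y η.1.1 ⟨_⟩

theorem lintegral_add_four {X : Type*} [MeasurableSpace X] {μ : Measure X} {f₁ f₂ f₃ : X → ℝ≥0∞}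
    (h₁ : Measurable f₁) (h₂ : Measurable f₂) (h₃ : Measurable f₃) (f₄ : X → ℝ≥0∞) :
    ∫⁻ x, f₁ x + f₂ x + f₃ x + f₄ x ∂μ =
      ∫⁻ x, f₁ x ∂μ + ∫⁻ x, f₂ x ∂μ + ∫⁻ x, f₃ x ∂μ + ∫⁻ x, f₄ x ∂μ := by
  rw [lintegral_add_left ((h₁.fun_add h₂).fun_add h₃), lintegral_add_left (h₁.fun_add h₂),
    lintegral_add_left h₁]

section

variable {g : Conf d → Conf d → ℝ≥0∞} {k : Pt d → Conf d → Conf d → Conf d → Conf d → ℝ≥0∞}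

theorem lintegral_deathPlus_conf2 (hd : 1 ≤ d) {z : ℝ} (hz : 0 < z)
    (hg : Measurable (Function.uncurry g)) (hk : MeasurableKer k) :
    ∫⁻ η : Conf2 d, deathPlus g k η.1.1 η.1.2 ∂(lebesguePoisson2 d z) =
      ∫⁻ η : Conf2 d, g η.1.1 η.1.2 * kerSumPlus z k η.1.1 η.1.2 ∂(lebesguePoisson2 d z) :=
  (lintegral_lebesguePoisson2 hd z (measurable_deathPlus hg hk)).trans
    ((lintegral_deathPlus hd hz.le hg hk).trans
      (lintegral_lebesguePoisson2 hd z (F := fun p q => g p q * kerSumPlus z k p q)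
        (hg.mul (measurable_kerSumPlus hk z))).symm)

theorem lintegral_deathMinus_conf2 (hd : 1 ≤ d) {z : ℝ} (hz : 0 < z)
    (hg : Measurable (Function.uncurry g)) (hk : MeasurableKer k) :
    ∫⁻ η : Conf2 d, deathMinus g k η.1.1 η.1.2 ∂(lebesguePoisson2 d z) =
      ∫⁻ η : Conf2 d, g η.1.1 η.1.2 * kerSumMinus z k η.1.1 η.1.2 ∂(lebesguePoisson2 d z) :=
  (lintegral_lebesguePoisson2 hd z (measurable_deathMinus hg hk)).trans
    ((lintegral_deathMinus hd hz.le hg hk).trans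
      (lintegral_lebesguePoisson2 hd z (F := fun p q => g p q * kerSumMinus z k p q)
        (hg.mul (measurable_kerSumMinus hk z))).symm)

theorem lintegral_birthPlus_conf2 (hd : 1 ≤ d) {z : ℝ} (hz : 0 < z)
    (hg : Measurable (Function.uncurry g)) (hk : MeasurableKer k) :
    ∫⁻ η : Conf2 d, birthPlus g k η.1.1 η.1.2 ∂(lebesguePoisson2 d z) =
      ∫⁻ η : Conf2 d, g η.1.1 η.1.2 *
        (ENNReal.ofReal (1 / z) * kerSumPlus z k η.1.1 η.1.2) ∂(lebesguePoisson2 d z) :=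
  (lintegral_lebesguePoisson2 hd z (measurable_birthPlus hg hk)).trans
    ((lintegral_birthPlus hd hz hg hk).trans
      (lintegral_lebesguePoisson2 hd z
        (F := fun p q => g p q * (ENNReal.ofReal (1 / z) * kerSumPlus z k p q))
        (hg.mul ((measurable_kerSumPlus hk z).const_mul _))).symm)

theorem lintegral_birthMinus_conf2 (hd : 1 ≤ d) {z : ℝ} (hz : 0 < z)
    (hg : Measurable (Function.uncurry g)) (hk : MeasurableKer k) :
    ∫⁻ η : Conf2 d, birthMinus g k η.1.1 η.1.2 ∂(lebesguePoisson2 d z) =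
      ∫⁻ η : Conf2 d, g η.1.1 η.1.2 *
        (ENNReal.ofReal (1 / z) * kerSumMinus z k η.1.1 η.1.2) ∂(lebesguePoisson2 d z) :=
  (lintegral_lebesguePoisson2 hd z (measurable_birthMinus hg hk)).trans
    ((lintegral_birthMinus hd hz hg hk).trans
      (lintegral_lebesguePoisson2 hd z
        (F := fun p q => g p q * (ENNReal.ofReal (1 / z) * kerSumMinus z k p q))
        (hg.mul ((measurable_kerSumMinus hk z).const_mul _))).symm)

end

/-- The central identity. The parameter of the measure is the `C` of the norms, so the factors `1 /
C` of `rateNormSum` are exactly those produced by the birth terms. -/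
theorem lintegral_majorant (hd : 1 ≤ d) (R : Rates d) {C : ℝ} (hC : 0 < C) {G : Conf2 d → ℝ}
    (hG : Measurable G) :
    ∫⁻ η : Conf2 d, majorant R G η.1.1 η.1.2 ∂(lebesguePoisson2 d C) =
      ∫⁻ η, ‖G η‖ₑ * rateNormSum R C η ∂(lebesguePoisson2 d C) := by
  have hg := measurable_absExtend hG
  have hdp := (measurableKer_rateKer R.dp_isRate).absKer
  have hbp := (measurableKer_rateKer R.bp_isRate).absKer
  have hdm := (measurableKer_rateKer R.dm_isRate).absKer
  have hbm := (measurableKer_rateKer R.bm_isRate).absKer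
  have hgv := measurable_comp_val hg
  simp only [majorant, rateNormSum_eq hd, ← absExtend_apply, mul_add]
  rw [lintegral_add_four (measurable_comp_val (measurable_deathPlus hg hdp))
      (measurable_comp_val (measurable_birthPlus hg hbp))
      (measurable_comp_val (measurable_deathMinus hg hdm)),
    lintegral_deathPlus_conf2 hd hC hg hdp, lintegral_birthPlus_conf2 hd hC hg hbp,
    lintegral_deathMinus_conf2 hd hC hg hdm, lintegral_birthMinus_conf2 hd hC hg hbm]
  exact (lintegral_add_four (hgv.fun_mul (measurable_comp_val (measurable_kerSumPlus hdp C)))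
    (hgv.fun_mul ((measurable_comp_val (measurable_kerSumPlus hbp C)).const_mul _))
    (hgv.fun_mul (measurable_comp_val (measurable_kerSumMinus hdm C))) _).symm

theorem measurable_majorant (R : Rates d) {G : Conf2 d → ℝ} (hG : Measurable G) :
    Measurable fun η : Conf2 d => majorant R G η.1.1 η.1.2 := by
  have hg := measurable_absExtend hG
  have hdp := (measurableKer_rateKer R.dp_isRate).absKer
  have hbp := (measurableKer_rateKer R.bp_isRate).absKer
  have hdm := (measurableKer_rateKer R.dm_isRate).absKer
  have hbm := (measurableKer_rateKer R.bm_isRate).absKer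
  exact (((measurable_comp_val (measurable_deathPlus hg hdp)).add
    (measurable_comp_val (measurable_birthPlus hg hbp))).add
    (measurable_comp_val (measurable_deathMinus hg hdm))).add
    (measurable_comp_val (measurable_birthMinus hg hbm))

open scoped Classical in
theorem lhatExpr_measurable (R : Rates d) {G : Conf2 d → ℝ} (hG : Measurable G) :
    Measurable (LhatExpr R G) := by
  have hg := measurable_extend hG
  have hv : Measurable (Subtype.val : Conf2 d → Conf d × Conf d) := measurable_subtype_coe
  have h1 := (measurable_deathPlus hg (measurableKer_rateKer R.dp_isRate)).comp hv
  have h3 := (measurable_deathMinus hg (measurableKer_rateKer R.dm_isRate)).comp hv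
  have h2 := (measurable_sum_powerset2 (H := fun p q a b : Conf d =>
    ∫ x, extend G ⟨p.pts ∪ {x}⟩ q * rateKer R.bp x p q a b)
    ((measurable_birthPlus_summand hg (measurableKer_rateKer R.bp_isRate)
      ).stronglyMeasurable.integral_prod_right' (ν := (volume : Measure (Pt d)))).measurable).comp hv
  have h4 := (measurable_sum_powerset2 (H := fun p q a b : Conf d =>
    ∫ y, extend G p ⟨q.pts ∪ {y}⟩ * rateKer R.bm y p q a b)
    ((measurable_birthMinus_summand hg (measurableKer_rateKer R.bm_isRate)
      ).stronglyMeasurable.integral_prod_right' (ν := (volume : Measure (Pt d)))).measurable).comp hv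
  exact ((h1.neg.add h2).sub h3).add h4

open scoped Classical in
theorem enorm_deathPlus_le (g : Conf d → Conf d → ℝ)
    (k : Pt d → Conf d → Conf d → Conf d → Conf d → ℝ) (a b : Conf d) :
    ‖deathPlus g k a b‖ₑ ≤ deathPlus (fun p q => ‖g p q‖ₑ) (absKer k) a b := by
  refine (enorm_sum_le _ _).trans (Finset.sum_le_sum fun p _ => ?_)
  refine (enorm_sum_le _ _).trans (Finset.sum_le_sum fun q _ => ?_)
  rw [enorm_mul]
  gcongr
  exact enorm_sum_le _ _

open scoped Classical in
theorem enorm_deathMinus_le (g : Conf d → Conf d → ℝ)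
    (k : Pt d → Conf d → Conf d → Conf d → Conf d → ℝ) (a b : Conf d) :
    ‖deathMinus g k a b‖ₑ ≤ deathMinus (fun p q => ‖g p q‖ₑ) (absKer k) a b := by
  refine (enorm_sum_le _ _).trans (Finset.sum_le_sum fun p _ => ?_)
  refine (enorm_sum_le _ _).trans (Finset.sum_le_sum fun q _ => ?_)
  rw [enorm_mul]
  gcongr
  exact enorm_sum_le _ _

/-- The triangle inequality needs no convergence: a birth integral that diverges has the default
value `0`. -/
theorem enorm_lhatExpr_le (R : Rates d) (G : Conf2 d → ℝ) (η : Conf2 d) :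
    ‖LhatExpr R G η‖ₑ ≤ majorant R G η.1.1 η.1.2 := by
  refine (enorm_add_le _ _).trans (add_le_add ?_ ?_)
  · refine enorm_sub_le.trans (add_le_add ?_ ?_)
    · refine (enorm_add_le _ _).trans (add_le_add ?_ ?_)
      · rw [enorm_neg]
        exact enorm_deathPlus_le (extend G) (rateKer R.dp) η.1.1 η.1.2
      · refine (enorm_sum_le _ _).trans (Finset.sum_le_sum fun p _ => ?_)
        refine (enorm_sum_le _ _).trans (Finset.sum_le_sum fun q _ => ?_)
        refine (enorm_integral_le_lintegral_enorm _).trans (lintegral_mono fun x => ?_)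
        exact (enorm_mul _ _).le
    · exact enorm_deathMinus_le (extend G) (rateKer R.dm) η.1.1 η.1.2
  · refine (enorm_sum_le _ _).trans (Finset.sum_le_sum fun p _ => ?_)
    refine (enorm_sum_le _ _).trans (Finset.sum_le_sum fun q _ => ?_)
    refine (enorm_integral_le_lintegral_enorm _).trans (lintegral_mono fun x => ?_)
    exact (enorm_mul _ _).le

open scoped Classical in
theorem lhatDefinedAt_of_majorant_lt_top (R : Rates d) {G : Conf2 d → ℝ} (hG : Measurable G)
    {η : Conf2 d} (h : majorant R G η.1.1 η.1.2 < ∞) : LhatDefinedAt R G η := by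
  intro p hp q hq
  have hp' := Finset.mem_powerset.2 hp
  have hq' := Finset.mem_powerset.2 hq
  have hg := measurable_extend hG
  rw [majorant, ENNReal.add_lt_top, ENNReal.add_lt_top, ENNReal.add_lt_top] at h
  constructor
  · have h1 := ENNReal.sum_lt_top.1 (ENNReal.sum_lt_top.1 h.1.1.2 p hp') q hq'
    refine ⟨((measurable_birthPlus_summand hg (measurableKer_rateKer R.bp_isRate)).comp
      (measurable_prodMk_left (x := ((⟨p⟩, ⟨q⟩, ⟨η.1.1.pts \ p⟩, ⟨η.1.2.pts \ q⟩) :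
        Conf d × Conf d × Conf d × Conf d)))).aestronglyMeasurable, ?_⟩
    refine lt_of_le_of_lt (lintegral_mono fun x => ?_) h1
    exact (enorm_mul _ _).le
  · have h1 := ENNReal.sum_lt_top.1 (ENNReal.sum_lt_top.1 h.2 p hp') q hq'
    refine ⟨((measurable_birthMinus_summand hg (measurableKer_rateKer R.bm_isRate)).comp
      (measurable_prodMk_left (x := ((⟨p⟩, ⟨q⟩, ⟨η.1.1.pts \ p⟩, ⟨η.1.2.pts \ q⟩) :
        Conf d × Conf d × Conf d × Conf d)))).aestronglyMeasurable, ?_⟩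
    refine lt_of_le_of_lt (lintegral_mono fun x => ?_) h1
    exact (enorm_mul _ _).le

/-! ### Independence of the representative -/

open scoped Classical in
/-- `F` and `G` have the same values at all places that enter `L̂F(η)` and `L̂G(η)`. -/
def AgreeAt (F G : Conf2 d → ℝ) (η : Conf2 d) : Prop :=
  ∀ p ⊆ η.1.1.pts, ∀ q ⊆ η.1.2.pts, val F p q = val G p q ∧
    (∀ᵐ x : Pt d, val F (p ∪ {x}) q = val G (p ∪ {x}) q) ∧
    (∀ᵐ y : Pt d, val F p (q ∪ {y}) = val G p (q ∪ {y}))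

theorem AgreeAt.lhatExpr_eq {F G : Conf2 d → ℝ} {η : Conf2 d} (h : AgreeAt F G η) (R : Rates d) :
    LhatExpr R F η = LhatExpr R G η := by
  unfold LhatExpr
  congr 1
  · congr 1
    · congr 1
      · congr 1
        refine Finset.sum_congr rfl fun p hp => Finset.sum_congr rfl fun q hq => ?_
        rw [(h p (Finset.mem_powerset.1 hp) q (Finset.mem_powerset.1 hq)).1]
      · refine Finset.sum_congr rfl fun p hp => Finset.sum_congr rfl fun q hq => ?_
        refine integral_congr_ae ?_
        filter_upwards [(h p (Finset.mem_powerset.1 hp) q (Finset.mem_powerset.1 hq)).2.1]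
          with x hx
        rw [hx]
    · refine Finset.sum_congr rfl fun p hp => Finset.sum_congr rfl fun q hq => ?_
      rw [(h p (Finset.mem_powerset.1 hp) q (Finset.mem_powerset.1 hq)).1]
  · refine Finset.sum_congr rfl fun p hp => Finset.sum_congr rfl fun q hq => ?_
    refine integral_congr_ae ?_
    filter_upwards [(h p (Finset.mem_powerset.1 hp) q (Finset.mem_powerset.1 hq)).2.2]
      with x hx
    rw [hx]

theorem AgreeAt.lhatDefinedAt {F G : Conf2 d → ℝ} {η : Conf2 d} (h : AgreeAt F G η) {R : Rates d}
    (hF : LhatDefinedAt R F η) : LhatDefinedAt R G η := by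
  intro p hp q hq
  obtain ⟨-, h2, h3⟩ := h p hp q hq
  refine ⟨(hF p hp q hq).1.congr ?_, (hF p hp q hq).2.congr ?_⟩
  · filter_upwards [h2] with x hx
    rw [hx]
  · filter_upwards [h3] with x hx
    rw [hx]

theorem val_eq_of_absExtend_indicator {Z : Set (Conf2 d)} {F G : Conf2 d → ℝ}
    (h : ∀ η ∉ Z, F η = G η) {p q : Finset (Pt d)}
    (hpq : absExtend (Z.indicator 1) ⟨p⟩ ⟨q⟩ = 0) : val F p q = val G p q := by
  rw [absExtend, enorm_eq_zero, extend] at hpq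
  unfold val at hpq ⊢
  by_cases hd : Disjoint p q
  · rw [dif_pos hd] at hpq
    rw [dif_pos hd, dif_pos hd]
    refine h _ fun hZ => ?_
    rw [Set.indicator_of_mem hZ] at hpq
    exact one_ne_zero hpq
  · rw [dif_neg hd, dif_neg hd]

open scoped Classical in
/-- If a nonnegative function on `Γ₀²` vanishes almost everywhere, then almost every `η` has the
property that it vanishes at all subconfigurations of `η` and at almost all configurations that
arise from these by adding a point. -/
theorem ae_subconf_eq_zero (hd : 1 ≤ d) {C : ℝ} (hC : 0 < C) {g : Conf d → Conf d → ℝ≥0∞}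
    (hg : Measurable (Function.uncurry g))
    (hg0 : ∀ᵐ η : Conf2 d ∂(lebesguePoisson2 d C), g η.1.1 η.1.2 = 0) :
    ∀ᵐ η : Conf2 d ∂(lebesguePoisson2 d C), ∀ p ⊆ η.1.1.pts, ∀ q ⊆ η.1.2.pts, g ⟨p⟩ ⟨q⟩ = 0 ∧
      (∀ᵐ x : Pt d, g ⟨p ∪ {x}⟩ ⟨q⟩ = 0) ∧ (∀ᵐ y : Pt d, g ⟨p⟩ ⟨q ∪ {y}⟩ = 0) := by
  have hg1 : ∀ A : Conf2 d → ℝ≥0∞,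
      ∫⁻ η : Conf2 d, g η.1.1 η.1.2 * A η ∂(lebesguePoisson2 d C) = 0 := by
    intro A
    rw [← lintegral_zero (μ := lebesguePoisson2 d C)]
    refine lintegral_congr_ae ?_
    filter_upwards [hg0] with η hη
    rw [hη, zero_mul]
  -- With kernel `1` the birth terms integrate `g` over all one-point additions to
  -- subconfigurations.
  have hk : MeasurableKer fun (_ : Pt d) (_ _ _ _ : Conf d) => (1 : ℝ≥0∞) := measurable_const
  have hH : Measurable fun w : Conf d × Conf d × Conf d × Conf d => g w.1 w.2.1 :=
    hg.comp (by fun_prop : Measurable fun w : Conf d × Conf d × Conf d × Conf d => (w.1, w.2.1))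
  have mS := measurable_sum_powerset2 (H := fun p q _ _ => g p q) hH
  have hSint : ∫⁻ η : Conf2 d, ∑ p ∈ η.1.1.pts.powerset, ∑ q ∈ η.1.2.pts.powerset,
      g ⟨p⟩ ⟨q⟩ ∂(lebesguePoisson2 d C) = 0 := by
    refine (lintegral_lebesguePoisson2 hd C mS).trans
      ((lintegral_sum_powerset2 hd hC.le (H := fun p q _ _ => g p q) hH).trans ?_)
    -- The total mass may be infinite; the product still vanishes since `0 * ∞ = 0` in `ℝ≥0∞`.
    rw [← hg1 fun _ => lebesguePoisson d C Set.univ * lebesguePoisson d C Set.univ]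
    refine Eq.trans ?_ (lintegral_lebesguePoisson2 hd C
      (F := fun p q => g p q * (lebesguePoisson d C Set.univ * lebesguePoisson d C Set.univ))
      (hg.mul_const _)).symm
    simp only [lintegral_const, mul_assoc]
  have hS := (lintegral_eq_zero_iff (measurable_comp_val mS)).1 hSint
  have hP := (lintegral_eq_zero_iff (measurable_comp_val (measurable_birthPlus hg hk))).1
    ((lintegral_birthPlus_conf2 hd hC hg hk).trans (hg1 _))
  have hM := (lintegral_eq_zero_iff (measurable_comp_val (measurable_birthMinus hg hk))).1
    ((lintegral_birthMinus_conf2 hd hC hg hk).trans (hg1 _))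
  filter_upwards [hS, hP, hM] with η h1 h2 h3 p hp q hq
  rw [Pi.zero_apply] at h1 h2 h3
  have hp' := Finset.mem_powerset.2 hp
  have hq' := Finset.mem_powerset.2 hq
  refine ⟨Finset.sum_eq_zero_iff.1 (Finset.sum_eq_zero_iff.1 h1 p hp') q hq', ?_, ?_⟩
  · rw [birthPlus] at h2
    have h2' := Finset.sum_eq_zero_iff.1 (Finset.sum_eq_zero_iff.1 h2 p hp') q hq'
    have hm : Measurable fun x : Pt d => g ⟨p ∪ {x}⟩ ⟨q⟩ :=
      hg.comp ((measurable_insert_conf (p := fun _ : Pt d => (⟨p⟩ : Conf d))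
        measurable_const measurable_id).prodMk measurable_const)
    simp only [mul_one] at h2'
    exact (lintegral_eq_zero_iff hm).1 h2'
  · rw [birthMinus] at h3
    have h3' := Finset.sum_eq_zero_iff.1 (Finset.sum_eq_zero_iff.1 h3 p hp') q hq'
    have hm : Measurable fun y : Pt d => g ⟨p⟩ ⟨q ∪ {y}⟩ :=
      hg.comp (measurable_const.prodMk (measurable_insert_conf
        (p := fun _ : Pt d => (⟨q⟩ : Conf d)) measurable_const measurable_id))
    simp only [mul_one] at h3'
    exact (lintegral_eq_zero_iff hm).1 h3'

theorem ae_agreeAt (hd : 1 ≤ d) {C : ℝ} (hC : 0 < C) {F G : Conf2 d → ℝ}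
    (h : F =ᵐ[lebesguePoisson2 d C] G) : ∀ᵐ η ∂(lebesguePoisson2 d C), AgreeAt F G η := by
  -- `F` and `G` need not be measurable, so the indicator of a measurable null set containing `{F ≠
  -- G}` takes the place of `|F - G|`.
  obtain ⟨Z, hsub, hZm, hZ0⟩ := exists_measurable_superset_of_null (ae_iff.1 h)
  have hFG : ∀ η ∉ Z, F η = G η := fun η hη => by
    by_contra hne
    exact hη (hsub hne)
  have hg0 : ∀ᵐ η : Conf2 d ∂(lebesguePoisson2 d C),
      absExtend (Z.indicator 1) η.1.1 η.1.2 = 0 := by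
    filter_upwards [measure_eq_zero_iff_ae_notMem.1 hZ0] with η hη
    rw [absExtend_apply, Set.indicator_of_notMem hη, enorm_zero]
  filter_upwards [ae_subconf_eq_zero hd hC
    (measurable_absExtend (measurable_one.indicator hZm)) hg0] with η hη p hp q hq
  obtain ⟨h1, h2, h3⟩ := hη p hp q hq
  refine ⟨val_eq_of_absExtend_indicator hFG h1, ?_, ?_⟩
  · filter_upwards [h2] with x hx
    exact val_eq_of_absExtend_indicator hFG hx
  · filter_upwards [h3] with y hy
    exact val_eq_of_absExtend_indicator hFG hy

/-! ### Linearity, the norm bound and the operator -/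

theorem val_add (F G : Conf2 d → ℝ) (p q : Finset (Pt d)) :
    val (F + G) p q = val F p q + val G p q := by
  unfold val
  split_ifs <;> simp

theorem val_smul (c : ℝ) (F : Conf2 d → ℝ) (p q : Finset (Pt d)) :
    val (c • F) p q = c * val F p q := by
  unfold val
  split_ifs <;> simp

/-- Bochner integrals add only for integrable functions, hence the two definedness hypotheses;
pulling out a scalar in `lhatExpr_smul` is unconditional. -/
theorem lhatExpr_add {R : Rates d} {F G : Conf2 d → ℝ} {η : Conf2 d} (hF : LhatDefinedAt R F η)
    (hG : LhatDefinedAt R G η) : LhatExpr R (F + G) η = LhatExpr R F η + LhatExpr R G η := by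
  have hsum : ∀ {A B T : Finset (Pt d) → Finset (Pt d) → ℝ},
      (∀ p ⊆ η.1.1.pts, ∀ q ⊆ η.1.2.pts, T p q = A p q + B p q) →
      ∑ p ∈ η.1.1.pts.powerset, ∑ q ∈ η.1.2.pts.powerset, T p q =
        ∑ p ∈ η.1.1.pts.powerset, ∑ q ∈ η.1.2.pts.powerset, A p q +
        ∑ p ∈ η.1.1.pts.powerset, ∑ q ∈ η.1.2.pts.powerset, B p q := by
    intro A B T h
    rw [← Finset.sum_add_distrib]
    refine Finset.sum_congr rfl fun p hp => ?_
    rw [← Finset.sum_add_distrib]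
    exact Finset.sum_congr rfl fun q hq =>
      h p (Finset.mem_powerset.1 hp) q (Finset.mem_powerset.1 hq)
  unfold LhatExpr
  simp only [val_add, add_mul]
  rw [hsum fun p _ q _ => rfl, hsum fun p hp q hq => integral_add (hF p hp q hq).1 (hG p hp q hq).1,
    hsum fun p _ q _ => rfl, hsum fun p hp q hq => integral_add (hF p hp q hq).2 (hG p hp q hq).2]
  ring

theorem lhatExpr_smul (R : Rates d) (c : ℝ) (F : Conf2 d → ℝ) (η : Conf2 d) :
    LhatExpr R (c • F) η = c * LhatExpr R F η := by
  unfold LhatExpr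
  simp only [val_smul, mul_assoc, integral_const_mul, ← Finset.mul_sum]
  ring

theorem lintegral_majorant_le (hd : 1 ≤ d) {R : Rates d} {C : ℝ} (hC : 0 < C) {N : Conf2 d → ℝ}
    (hN : RatesBoundedBy R C N) {G : Conf2 d → ℝ} (hG : Measurable G) :
    ∫⁻ η : Conf2 d, majorant R G η.1.1 η.1.2 ∂(lebesguePoisson2 d C) ≤
      normLC C fun η => N η * G η := by
  rw [lintegral_majorant hd R hC hG, normLC, eLpNorm_one_eq_lintegral_enorm]
  refine lintegral_mono_ae ?_
  -- The bound by `N` is assumed for parameter `1` and is needed for parameter `C`.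
  filter_upwards [(lebesguePoisson2_absolutelyContinuous d one_pos).ae_le hN] with η hη
  rw [enorm_mul, mul_comm, Real.enorm_eq_ofReal hη.1]
  gcongr
  exact hη.2

theorem ae_lhatDefinedAt (hd : 1 ≤ d) {R : Rates d} {C : ℝ} (hC : 0 < C) {N : Conf2 d → ℝ}
    (hN : RatesBoundedBy R C N) {G : Conf2 d → ℝ} (hG : Measurable G)
    (hNG : MemLp (fun η => N η * G η) 1 (lebesguePoisson2 d C)) :
    ∀ᵐ η ∂(lebesguePoisson2 d C), LhatDefinedAt R G η := by
  filter_upwards [ae_lt_top (measurable_majorant R hG)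
    ((lintegral_majorant_le hd hC hN hG).trans_lt hNG.2).ne] with η hη
  exact lhatDefinedAt_of_majorant_lt_top R hG hη

theorem normLC_lhatExpr_le (hd : 1 ≤ d) {R : Rates d} {C : ℝ} (hC : 0 < C) {N : Conf2 d → ℝ}
    (hN : RatesBoundedBy R C N) {G : Conf2 d → ℝ} (hG : Measurable G) :
    normLC C (LhatExpr R G) ≤ normLC C fun η => N η * G η := by
  refine le_trans ?_ (lintegral_majorant_le hd hC hN hG)
  rw [normLC, eLpNorm_one_eq_lintegral_enorm]
  exact lintegral_mono fun η => enorm_lhatExpr_le R G η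

theorem memLp_lhatExpr (hd : 1 ≤ d) {R : Rates d} {C : ℝ} (hC : 0 < C) {N : Conf2 d → ℝ}
    (hN : RatesBoundedBy R C N) {G : Conf2 d → ℝ} (hG : Measurable G)
    (hNG : MemLp (fun η => N η * G η) 1 (lebesguePoisson2 d C)) :
    MemLp (LhatExpr R G) 1 (lebesguePoisson2 d C) :=
  ⟨(lhatExpr_measurable R hG).aestronglyMeasurable,
    (normLC_lhatExpr_le hd hC hN hG).trans_lt hNG.2⟩

theorem measurable_coe_LC {C : ℝ} (g : LC d C) : Measurable (g : Conf2 d → ℝ) :=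
  (Lp.stronglyMeasurable g).measurable

/-- The operator `L̂` with domain `𝓓`. -/
def lhat (hd : 1 ≤ d) {R : Rates d} {C : ℝ} (hC : 0 < C) {N : Conf2 d → ℝ}
    (hN : RatesBoundedBy R C N) : LC d C →ₗ.[ℝ] LC d C where
  domain := domainD N C
  toFun :=
    { toFun := fun g => (memLp_lhatExpr hd hC hN (measurable_coe_LC g.1) g.2).toLp _
      map_add' := by
        intro g h
        refine Lp.ext ?_
        have hg := memLp_lhatExpr hd hC hN (measurable_coe_LC g.1) g.2
        have hh := memLp_lhatExpr hd hC hN (measurable_coe_LC h.1) h.2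
        have hgh := memLp_lhatExpr hd hC hN (measurable_coe_LC (g + h).1) (g + h).2
        -- The chosen representative of `g + h` equals the sum of those of `g` and `h` only almost
        -- everywhere; `ae_agreeAt` makes that enough.
        filter_upwards [hgh.coeFn_toLp, hg.coeFn_toLp, hh.coeFn_toLp,
          Lp.coeFn_add (hg.toLp _) (hh.toLp _), ae_agreeAt hd hC (Lp.coeFn_add g.1 h.1),
          ae_lhatDefinedAt hd hC hN (measurable_coe_LC g.1) g.2,
          ae_lhatDefinedAt hd hC hN (measurable_coe_LC h.1) h.2] with η e1 e2 e3 e4 e5 e6 e7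
        rw [e1, e4, Pi.add_apply, e2, e3, ← lhatExpr_add e6 e7]
        exact e5.lhatExpr_eq R
      map_smul' := by
        intro c g
        refine Lp.ext ?_
        have hg := memLp_lhatExpr hd hC hN (measurable_coe_LC g.1) g.2
        have hcg := memLp_lhatExpr hd hC hN (measurable_coe_LC (c • g).1) (c • g).2
        filter_upwards [hcg.coeFn_toLp, hg.coeFn_toLp, Lp.coeFn_smul c (hg.toLp _),
          ae_agreeAt hd hC (Lp.coeFn_smul c g.1)] with η e1 e2 e3 e4
        rw [e1, RingHom.id_apply, e3, Pi.smul_apply, e2, smul_eq_mul, ← lhatExpr_smul]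
        exact e4.lhatExpr_eq R }

theorem coe_lhat (hd : 1 ≤ d) {R : Rates d} {C : ℝ} (hC : 0 < C) {N : Conf2 d → ℝ}
    (hN : RatesBoundedBy R C N) (g : (lhat hd hC hN).domain) :
    lhat hd hC hN g =ᵐ[lebesguePoisson2 d C] LhatExpr R (g : LC d C) :=
  (memLp_lhatExpr hd hC hN (measurable_coe_LC g.1) g.2).coeFn_toLp

/-- The functions `G` with `N G` integrable are dense, because `N` is finite. -/
theorem dense_domainD {C : ℝ} {N : Conf2 d → ℝ}
    (hN : AEMeasurable N (lebesguePoisson2 d C)) : Dense (domainD N C : Set (LC d C)) := by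
  set μ := lebesguePoisson2 d C
  intro g
  set M := hN.mk N with hM
  have hMm : Measurable M := hN.measurable_mk
  -- As `M` is real-valued, these sets exhaust the space. The cut-off of `g` to `S n` lies in the
  -- domain because `|M| ≤ n` there, and it tends to `g` by dominated convergence.
  set S : ℕ → Set (Conf2 d) := fun n => {η | |M η| ≤ n} with hS
  have hSm : ∀ n, MeasurableSet (S n) := fun n =>
    measurableSet_le hMm.abs measurable_const
  have hgL : MemLp g 1 μ := Lp.memLp g
  have hmem : ∀ n, MemLp ((S n).indicator g) 1 μ := fun n => hgL.indicator (hSm n)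
  have key : Filter.Tendsto (fun n => (hmem n).toLp _) Filter.atTop (nhds (hgL.toLp g)) := by
    rw [Lp.tendsto_Lp_iff_tendsto_eLpNorm'']
    simp only [eLpNorm_one_eq_lintegral_enorm]
    rw [← lintegral_zero (μ := μ)]
    refine tendsto_lintegral_of_dominated_convergence (fun η => ‖g η‖ₑ) (fun n => ?_) (fun n => ?_)
      ?_ ?_
    · exact (((measurable_coe_LC g).indicator (hSm n)).sub (measurable_coe_LC g)).enorm
    · refine Filter.Eventually.of_forall fun η => ?_
      by_cases hη : η ∈ S n <;> simp [hη]
    · rw [← eLpNorm_one_eq_lintegral_enorm]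
      exact hgL.2.ne
    · refine Filter.Eventually.of_forall fun η => ?_
      obtain ⟨n₀, hn₀⟩ := exists_nat_ge |M η|
      refine tendsto_const_nhds.congr' ?_
      filter_upwards [Filter.eventually_ge_atTop n₀] with n hn
      have : η ∈ S n := hn₀.trans (by exact_mod_cast hn)
      simp [this]
  rw [Lp.toLp_coeFn] at key
  refine mem_closure_of_tendsto key (Filter.Eventually.of_forall fun n => ?_)
  have hb : MemLp (fun η => M η * (S n).indicator g η) 1 μ := by
    refine ((hmem n).const_mul (n : ℝ)).of_le
      (hMm.mul ((measurable_coe_LC g).indicator (hSm n))).aestronglyMeasurable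
      (Filter.Eventually.of_forall fun η => ?_)
    by_cases hη : η ∈ S n
    · rw [norm_mul, norm_mul, Real.norm_natCast]
      exact mul_le_mul_of_nonneg_right hη (norm_nonneg _)
    · simp [hη]
  refine hb.ae_eq ?_
  filter_upwards [hN.ae_eq_mk, (hmem n).coeFn_toLp] with η h1 h2
  rw [h2, h1]

end BirthDeath

end

theorem mainTheorem3 (d : ℕ) (hd : 1 ≤ d) (R : Rates d) (C : ℝ) (hC : 0 < C)
    (N : Conf2 d → ℝ) (hNmeas : AEMeasurable N (lebesguePoisson2 d 1))
    (hNint : LocallyIntegrableBound N) (hN : RatesBoundedBy R C N) :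
    Dense (domainD N C : Set (LC d C)) ∧
    ∃ L : LC d C →ₗ.[ℝ] LC d C, L.domain = domainD N C ∧
      ∀ (g : L.domain) (G : Conf2 d → ℝ), G =ᵐ[lebesguePoisson2 d C] (g : LC d C) →
        (∀ᵐ η ∂(lebesguePoisson2 d 1), LhatDefinedAt R G η) ∧
        L g =ᵐ[lebesguePoisson2 d C] LhatExpr R G ∧
        normLC C (L g) ≤ normLC C (fun η => N η * G η) := by
  refine ⟨dense_domainD (hNmeas.mono_ac (lebesguePoisson2_absolutelyContinuous d one_pos)),
    lhat hd hC hN, rfl, fun g G hG => ?_⟩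
  have hagree := ae_agreeAt hd hC hG.symm
  have hm := measurable_coe_LC g.1
  -- Convergence is known almost everywhere for parameter `C` and is transferred to parameter `1`.
  -- The arbitrary representative `G` is compared with the canonical one through `AgreeAt`.
  refine ⟨(lebesguePoisson2_absolutelyContinuous d hC).ae_le ?_, ?_, ?_⟩
  · filter_upwards [hagree, ae_lhatDefinedAt hd hC hN hm g.2] with η h1 h2
    exact h1.lhatDefinedAt h2
  · filter_upwards [hagree, coe_lhat hd hC hN g] with η h1 h2
    rw [h2, h1.lhatExpr_eq R]
  · have h1 : normLC C (lhat hd hC hN g) = normLC C (LhatExpr R (g : LC d C)) :=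
      eLpNorm_congr_ae (coe_lhat hd hC hN g)
    have h2 : normLC C (fun η => N η * G η) = normLC C (fun η => N η * (g : LC d C) η) := by
      refine eLpNorm_congr_ae ?_
      filter_upwards [hG] with η h
      rw [h]
    rw [h1, h2]
    exact normLC_lhatExpr_le hd hC hN hm
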